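/- Let $q\ge 2$ and consider a generalized Pólya urn with $q$ types of balls: activities $a_1,\dots,a_q\ge 0$, random replacement vectors $\xi_1,\dots,\xi_q\in\mathbb R^q$, and a non-random initial composition $X_0\in\mathbb R_{\ge 0}^q$ with $a\cdot X_0>0$. Write $S_n=a\cdot X_n$. At each step, if $S_n>0$, a ball of type $i$ is drawn with probability $a_iX_{n,i}/S_n$ and, independently of the past given this type, $X_{n+1}=X_n+\Delta X_n$ with $\Delta X_n\sim\xi_i$; if $S_n=0$ then $X_{n+1}=X_n$. Let $\mathcal E_n^c=\{S_k>0\text{ for all }0\le k\le n\}$ and let $A=(a_j\,\mathbb E\xi_{j,i})_{i,j=1}^q$. Let $p\ge 2$ be real and assume: (a) the urn is tenable, i.e. almost surely $X_n\in\mathbb R_{\ge0}^q$ for all $n$; (b) it is balanced in expectation: there is $b>0$ with $\sum_j a_j\mathbb E\xi_{i,j}=b$ for every $i$ with $a_i>0$; (c) the eigenvalues of $A$, counted with algebraic multiplicity, can be labelled $\lambda_1,\dots,\lambda_q$ with $\lambda_1=b$ and $\operatorname{Re}\lambda_1\ge\operatorname{Re}\lambda_2\ge\dots\ge\operatorname{Re}\lambda_q$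 (that is, $b\ge\operatorname{Re}\lambda$ for every eigenvalue $\lambda$); among $\lambda_2,\dots,\lambda_q$, eigenvalues with equal real part are listed in non-increasing order of $\nu_\lambda$, where $\nu_\lambda+1$ is the size of the largest Jordan block of $A$ with $\lambda$ on the diagonal; (d) $\|\xi_i\|_p=(\mathbb E|\xi_i|^p)^{1/p}<\infty$ for all $i$, where $|\cdot|$ is the Euclidean norm. Put $\nu_2=\nu_{\lambda_2}$. Then there is a constant $C_p$, depending only on $p$, $q$, $a$, $X_0$ and the distributions of $\xi_1,\dots,\xi_q$, such that for all $n\ge 2$ we have $\mathbb P(\mathcal E_n^c)>0$, $X_n$ is integrable, and $$\big\|(X_n-\mathbb E[X_n\mid\mathcal E_n^c])\mathbf 1_{\mathcal E_n^c}\big\|_p\le\begin{cases}C_p\,n^{1/2}, & \operatorname{Re}\lambda_2<\lambda_1/2,\\ C_p\,n^{1/2}(\log n)^{\nu_2+1}, & \operatorname{Re}\lambda_2=\lambda_1/2,\\ C_p\,n^{\operatorname{Re}\lambda_2/\lambda_1}(\log n)^{\nu_2}, & \operatorname{Re}\lambda_2>\lambda_1/2,\end{cases}$$ where $\mathbb E[\,\cdot\mid\mathcal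 E_n^c]$ denotes expectation conditioned on the event $\mathcal E_n^c$. -/

import Mathlib

open MeasureTheory ProbabilityTheory

/-- The data of a generalized Pólya urn with `q` types of balls: the activities `a_i ≥ 0`,
the laws of the random replacement vectors `ξ_i`, and a deterministic initial composition `X_0`
with positive total activity. -/
structure PolyaUrn (q : ℕ) where
  activity : Fin q → ℝ
  activity_nonneg : ∀ i, 0 ≤ activity i
  replacement : Fin q → Measure (EuclideanSpace ℝ (Fin q))
  isProbabilityMeasure_replacement : ∀ i, IsProbabilityMeasure (replacement i)
  init : EuclideanSpace ℝ (Fin q)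
  init_nonneg : ∀ i, 0 ≤ init i
  init_activity_pos : 0 < ∑ i, activity i * init i

namespace PolyaUrn

noncomputable section

variable {q : ℕ} (U : PolyaUrn q)

/-- Total activity `a · x` of a composition `x`. -/
def totalActivity (x : EuclideanSpace ℝ (Fin q)) : ℝ := ∑ i, U.activity i * x i

/-- The probability that a ball of type `i` is drawn from the composition `x`
(of positive total activity). -/
def drawProb (x : EuclideanSpace ℝ (Fin q)) (i : Fin q) : ℝ :=
  U.activity i * x i / U.totalActivity x

open Classical in
/-- The probability that the replacement vector lies in `B` when the current composition is `x`:
a ball is drawn, its type being `i` with probability `U.drawProb x i`, and the replacement vector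
then has the law of `ξ_i`; if the total activity is not positive, no ball is drawn and the
replacement vector is `0`. -/
def stepProb (x : EuclideanSpace ℝ (Fin q)) (B : Set (EuclideanSpace ℝ (Fin q))) : ℝ :=
  if 0 < U.totalActivity x then ∑ i, U.drawProb x i * (U.replacement i).real B
  else if (0 : EuclideanSpace ℝ (Fin q)) ∈ B then 1 else 0

/-- `X` is (a version of) the urn process with data `U`: it starts at `X_0`, and conditionally on
the whole past `X_0, …, X_n` the replacement vector `X_{n+1} - X_n` has the law described by
`stepProb` at `X_n`. -/
structure IsUrnChain {Ω : Type*} [MeasurableSpace Ω] (P : Measure Ω)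
    (X : ℕ → Ω → EuclideanSpace ℝ (Fin q)) : Prop where
  measurable : ∀ n, Measurable (X n)
  init_eq : ∀ᵐ ω ∂P, X 0 ω = U.init
  step : ∀ (n : ℕ) (B : Set (EuclideanSpace ℝ (Fin q))), MeasurableSet B →
    P[({ω | X (n + 1) ω - X n ω ∈ B}).indicator (fun _ => (1 : ℝ)) |
        ⨆ k ≤ n, MeasurableSpace.comap (X k) inferInstance]
      =ᵐ[P] fun ω => U.stepProb (X n ω) B

/-- Tenability: almost surely, all compositions are non-negative at each step. -/
def Tenable {Ω : Type*} [MeasurableSpace Ω] (P : Measure Ω)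
    (X : ℕ → Ω → EuclideanSpace ℝ (Fin q)) : Prop :=
  ∀ n, ∀ᵐ ω ∂P, ∀ i, 0 ≤ X n ω i

/-- Non-extinction up to time `n`: the total activities at times `0, …, n` are all positive. -/
def nonExtinct {Ω : Type*} (X : ℕ → Ω → EuclideanSpace ℝ (Fin q)) (n : ℕ) : Set Ω :=
  {ω | ∀ k ≤ n, 0 < U.totalActivity (X k ω)}

/-- `E[X_n | E_n^c]`, the expectation conditioned on the event of non-extinction up to time `n`. -/
def condMean {Ω : Type*} [MeasurableSpace Ω] (P : Measure Ω)
    (X : ℕ → Ω → EuclideanSpace ℝ (Fin q)) (n : ℕ) : EuclideanSpace ℝ (Fin q) :=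
  ∫ ω, X n ω ∂(ProbabilityTheory.cond P (U.nonExtinct X n))

/-- The random vector `(X_n - E[X_n | E_n^c]) 1_{E_n^c}`. -/
def centered {Ω : Type*} [MeasurableSpace Ω] (P : Measure Ω)
    (X : ℕ → Ω → EuclideanSpace ℝ (Fin q)) (n : ℕ) : Ω → EuclideanSpace ℝ (Fin q) :=
  (U.nonExtinct X n).indicator fun ω => X n ω - U.condMean P X n

/-- The urn is balanced in expectation with constant `b`. -/
def BalancedInExpectation (b : ℝ) : Prop :=
  0 < b ∧ ∀ i, 0 < U.activity i → ∑ j, U.activity j * ∫ x, x j ∂(U.replacement i) = b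

/-- The intensity matrix `A = (a_j E ξ_{j,i})_{i,j}`. -/
def intensityMatrix : Matrix (Fin q) (Fin q) ℝ :=
  Matrix.of fun i j => U.activity j * ∫ x, x i ∂(U.replacement j)

/-- The intensity matrix as a complex matrix. -/
def intensityMatrixC : Matrix (Fin q) (Fin q) ℂ :=
  U.intensityMatrix.map (fun r : ℝ => (r : ℂ))

/-- `ν_z`: the least `k` for which `(A - z)^(k+1)` vanishes on the generalized eigenspace of `z`,
i.e. `N_z^(k+1) = 0` for the nilpotent part `N_z` of `A` at the eigenvalue `z`. Equivalently,
`ν_z + 1` is the size of the largest Jordan block of `A` with `z` on the diagonal. -/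
def nu (z : ℂ) : ℕ :=
  sInf {k : ℕ | ∀ v : Fin q → ℂ,
    (∃ m : ℕ, ((U.intensityMatrixC - Matrix.scalar (Fin q) z) ^ m).mulVec v = 0) →
      ((U.intensityMatrixC - Matrix.scalar (Fin q) z) ^ (k + 1)).mulVec v = 0}

/-- `ev` lists the eigenvalues `λ_1, …, λ_q` of the intensity matrix (with algebraic multiplicity;
`λ_{i+1}` is `ev i`) in decreasing order of real parts, with `λ_1 = b`, and, among
`λ_2, …, λ_q` of equal real part, in decreasing order of Jordan block size. -/
structure IsEigenvalueLabelling (b : ℝ) (ev : Fin q → ℂ) : Prop where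
  roots_eq : U.intensityMatrixC.charpoly.roots = Finset.univ.val.map ev
  first_eq : ∀ i : Fin q, i.val = 0 → ev i = (b : ℂ)
  re_antitone : ∀ i j : Fin q, i ≤ j → (ev j).re ≤ (ev i).re
  nu_antitone : ∀ i j : Fin q, 1 ≤ i.val → i ≤ j → (ev i).re = (ev j).re →
    U.nu (ev j) ≤ U.nu (ev i)

end

end PolyaUrn

/-! The law of large numbers pulls the total activity `S_n` towards `σ_n = S_0 + b n`, so the urn is
compared with the deterministic recursion `c_{n+1} = c_n + A c_n / σ_n`, `c_0 = X_0`. Centering at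
any deterministic vector is as good as centering at the conditional mean, up to a factor two
(`eLpNorm_indicator_sub_cond_integral_le`), so it suffices to bound `X_n - c_n` on survival.

By balance in expectation, the activity vector `a` is a left eigenvector of `A` for `b`. Hence
`S_n - σ_n` agrees on survival with a martingale with increments bounded in `L^p`, of order `√n`
(`PolyaUrn.exists_lpLe_activityMg`). For the rest of `X_n - c_n`, fix `w` with `a · w = 1` and
project along `w` to the space `a · x = 0`. The projected deviation `Y` satisfies
`Y_{k+1} = (1 + A / σ_k) Y_k + R_k`, where `R_k` is the projection of a martingale difference plus
the error of replacing `A X_k / S_k` by `A X_k / σ_k` (`PolyaUrn.projected_step`). Since `A X_k / S_k`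
is a mixture of the vectors `E ξ_j`, it is bounded, and the error has `L^p` norm
`O(|S_k - σ_k| / σ_k) = O(k ^ (-1 / 2))`. No bound on `X_k / S_k` is needed, which would fail in the
presence of types of activity zero.

Variation of constants (`eq_sum_eulerProp`) writes `Y_n` as the sum of `∏_{k < j < n} (1 + A / σ_j)`
applied to `R_k`. On the space `a · x = 0` only the eigenvalues `λ_2, …, λ_q` occur: if `b` itself
still has a generalized eigenvector there, then its algebraic multiplicity is at least two and it is
one of `λ_2, …, λ_q` (`two_le_rootMultiplicity`). A direct estimate on generalized eigenvectors
(`hasGrowth_of_pow_apply_eq_zero`) bounds the product by a constant times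
`(n / k) ^ (Re λ_2 / b) * (1 + log n) ^ ν_2`. The martingale part is then bounded by the square
root of the sum of the squares of these weights (`exists_integral_abs_sum_rpow_le`, which follows by
induction from a Taylor estimate for `|x + y| ^ p`), and the drift part by their sum against
`k ^ (-1 / 2)`. The three regimes are those of the sums `∑ k ^ (-2 r)` and `∑ k ^ (-r - 1 / 2)` with
`r = Re λ_2 / b`. For `r < 1 / 2` the exponent is first raised, still below `1 / 2`, to absorb the
logarithms.
-/

/-! ### A moment inequality for martingales -/

/-- Second-order Taylor bound for `|1 + t| ^ p`, global in `t`. -/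
theorem abs_one_add_rpow_le {p : ℝ} (hp : 2 ≤ p) :
    ∃ C : ℝ, 1 ≤ C ∧ ∀ t : ℝ, |1 + t| ^ p ≤ 1 + p * t + C * (t ^ 2 + |t| ^ p) := by
  have hp0 : 0 ≤ p := by linarith
  set C : ℝ := p ^ 2 * Real.exp p + 2 * p + 3 ^ p with hC
  have h3 : 0 ≤ (3 : ℝ) ^ p := by positivity
  have hpe : 0 ≤ p ^ 2 * Real.exp p := by positivity
  refine ⟨C, by linarith, fun t => ?_⟩
  have hts : 0 ≤ |t| ^ p := by positivity
  have ht2 : 0 ≤ t ^ 2 := by positivity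
  rcases le_or_gt |t| (1 / 2) with ht | ht
  · have ht' := abs_le.1 ht
    have h1 : |1 + t| ^ p ≤ Real.exp (p * t) := by
      rw [abs_of_nonneg (by linarith), mul_comm, Real.exp_mul]
      refine Real.rpow_le_rpow (by linarith) ?_ hp0
      linarith [Real.add_one_le_exp t]
    have h2 : Real.exp (p * t) ≤ 1 + p * t + p ^ 2 * Real.exp p * t ^ 2 := by
      -- `exp u - 1 ≤ u * exp u` gives `exp u - 1 - u ≤ u * (exp u - 1)`, where `exp u - 1` lies
      -- between `u` and `u * exp u`
      have key : ∀ u : ℝ, |u| ≤ p → Real.exp u - 1 - u ≤ u ^ 2 * Real.exp p := by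
        intro u hu
        have e1 := Real.add_one_le_exp (-u)
        have e2 : Real.exp u * Real.exp (-u) = 1 := by rw [← Real.exp_add]; simp
        have e3 := Real.add_one_le_exp u
        have e0 := Real.exp_pos u
        have e5 : Real.exp u - 1 ≤ u * Real.exp u := by nlinarith
        have hup := abs_le.1 hu
        have hep : Real.exp u ≤ Real.exp p := Real.exp_le_exp.2 hup.2
        have hep1 : 1 ≤ Real.exp p := Real.one_le_exp hp0
        rcases le_or_gt 0 u with h | h
        · nlinarith [mul_le_mul_of_nonneg_left e5 h, mul_le_mul_of_nonneg_left hep (sq_nonneg u)]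
        · nlinarith [mul_le_mul_of_nonneg_left hep1 (sq_nonneg u)]
      have := key (p * t) (by rw [abs_mul, abs_of_nonneg hp0]; nlinarith [abs_nonneg t])
      nlinarith
    have h4 : p ^ 2 * Real.exp p * t ^ 2 ≤ C * (t ^ 2 + |t| ^ p) := by
      have : p ^ 2 * Real.exp p ≤ C := by linarith
      nlinarith [mul_le_mul_of_nonneg_right this ht2]
    linarith
  · have h1 : |1 + t| ≤ 3 * |t| := by
      calc |1 + t| ≤ |1| + |t| := abs_add_le _ _
        _ ≤ 3 * |t| := by rw [abs_one]; linarith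
    have h2 : |1 + t| ^ p ≤ 3 ^ p * |t| ^ p := by
      rw [← Real.mul_rpow (by norm_num) (abs_nonneg _)]
      exact Real.rpow_le_rpow (abs_nonneg _) h1 hp0
    have h3' : -(p * t) ≤ 2 * p * t ^ 2 := by
      have : -t ≤ 2 * t ^ 2 := by
        have := neg_abs_le t
        nlinarith [sq_abs t]
      nlinarith
    have h5 : 3 ^ p * |t| ^ p + 2 * p * t ^ 2 ≤ C * (t ^ 2 + |t| ^ p) := by
      have e1 : (3 : ℝ) ^ p ≤ C := by linarith
      have e2 : 2 * p ≤ C := by linarith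
      nlinarith [mul_le_mul_of_nonneg_right e1 hts, mul_le_mul_of_nonneg_right e2 ht2]
    linarith

theorem abs_add_rpow_le {p : ℝ} (hp : 2 ≤ p) :
    ∃ C : ℝ, 1 ≤ C ∧ ∀ x y : ℝ, |x + y| ^ p ≤
      |x| ^ p + p * (|x| ^ (p - 2) * x * y) + C * (|x| ^ (p - 2) * y ^ 2 + |y| ^ p) := by
  obtain ⟨C, hC, h⟩ := abs_one_add_rpow_le hp
  refine ⟨C, hC, fun x y => ?_⟩
  rcases eq_or_ne x 0 with rfl | hx
  · have h0 : (0 : ℝ) ^ p = 0 := Real.zero_rpow (by linarith)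
    have h1 : 0 ≤ |(0 : ℝ)| ^ (p - 2) * y ^ 2 := by positivity
    have h2 : 0 ≤ |y| ^ p := by positivity
    simp only [zero_add, mul_zero, zero_mul, add_zero]
    rw [abs_zero] at *
    rw [h0]
    nlinarith
  · have hx' : 0 < |x| := abs_pos.2 hx
    have e1 : |x| ^ p = |x| ^ (p - 2) * x ^ 2 := by
      rw [← sq_abs x, ← Real.rpow_natCast, ← Real.rpow_add hx']; norm_num
    have e2 : |x + y| ^ p = |x| ^ p * |1 + y / x| ^ p := by
      rw [← Real.mul_rpow (abs_nonneg _) (abs_nonneg _), ← abs_mul]; congr 2; field_simp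
    have e3 : |y| ^ p = |x| ^ p * |y / x| ^ p := by
      rw [← Real.mul_rpow (abs_nonneg _) (abs_nonneg _), ← abs_mul]; congr 2; field_simp
    have e4 : |x| ^ (p - 2) * x * y = |x| ^ p * (y / x) := by rw [e1]; field_simp
    have e5 : |x| ^ (p - 2) * y ^ 2 = |x| ^ p * (y / x) ^ 2 := by rw [e1]; field_simp
    rw [e2, e3, e4, e5]
    have := mul_le_mul_of_nonneg_left (h (y / x)) (Real.rpow_nonneg hx'.le p)
    linarith

/-- A crude form of Young's inequality, enough to replace Hölder's inequality when both functions
are normalised. -/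
theorem rpow_mul_rpow_le_add {α β r s : ℝ} (hα : 0 ≤ α) (hβ : 0 ≤ β) (hr : 0 ≤ r)
    (hs : 0 ≤ s) : α ^ r * β ^ s ≤ α ^ (r + s) + β ^ (r + s) := by
  rw [Real.rpow_add_of_nonneg hα hr hs, Real.rpow_add_of_nonneg hβ hr hs]
  have h1 := Real.rpow_nonneg hα r
  have h2 := Real.rpow_nonneg hα s
  have h3 := Real.rpow_nonneg hβ r
  have h4 := Real.rpow_nonneg hβ s
  rcases le_total α β with h | h
  · nlinarith [mul_le_mul_of_nonneg_right (Real.rpow_le_rpow hα h hr) h4, mul_nonneg h1 h2]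
  · nlinarith [mul_le_mul_of_nonneg_left (Real.rpow_le_rpow hβ h hs) h1, mul_nonneg h3 h4]

/-- The recursion `B ↦ B + K δ²` dominates one step of the moment inequality. -/
theorem rpow_add_mul_le {s : ℝ} (hs : 1 ≤ s) {C K B D : ℝ} (hC : 0 ≤ C) (hK : 2 * C ≤ K)
    (hK1 : 1 ≤ K) (hB : 0 < B) (hD : 0 < D) :
    B ^ s + C * (B ^ (s - 1) * D + D ^ s) ≤ (B + K * D) ^ s := by
  have hy : 0 < K * D := by positivity
  have e : ∀ x : ℝ, 0 < x → x ^ s = x * x ^ (s - 1) := by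
    intro x hx
    nth_rewrite 2 [← Real.rpow_one x]
    rw [← Real.rpow_add hx]; congr 1; ring
  have h1 : B ^ (s - 1) ≤ (B + K * D) ^ (s - 1) :=
    Real.rpow_le_rpow hB.le (by linarith) (by linarith)
  have h2 : D ^ (s - 1) ≤ (B + K * D) ^ (s - 1) :=
    Real.rpow_le_rpow hD.le (by nlinarith) (by linarith)
  have h0 : 0 ≤ D ^ (s - 1) := by positivity
  have h0' : 0 ≤ B ^ (s - 1) := by positivity
  rw [e B hB, e D hD, e (B + K * D) (by positivity)]
  have h3 : C * (B ^ (s - 1) * D + D * D ^ (s - 1)) ≤ 2 * C * D * (B + K * D) ^ (s - 1) := by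
    have : C * D * (B ^ (s - 1) + D ^ (s - 1)) ≤ C * D * (2 * (B + K * D) ^ (s - 1)) :=
      mul_le_mul_of_nonneg_left (by linarith) (by positivity)
    linarith
  have h4 : 2 * C * D * (B + K * D) ^ (s - 1) ≤ K * D * (B + K * D) ^ (s - 1) :=
    mul_le_mul_of_nonneg_right (by nlinarith) (by positivity)
  nlinarith [mul_le_mul_of_nonneg_left h1 hB.le]

/-- **Moment inequality for martingales.** For `p ≥ 2`, the `p`-th moment of a sum of martingale
differences `d k` with `‖d k‖_p ≤ δ k` is at most `(β + K ∑ δ k ^ 2) ^ (p / 2)`. The parameter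
`β > 0` keeps the bound positive from the start. -/
theorem exists_integral_abs_sum_rpow_le {p : ℝ} (hp : 2 ≤ p) :
    ∃ K : ℝ, 1 ≤ K ∧ ∀ {Ω : Type*} {m : MeasurableSpace Ω} (μ : Measure Ω) [IsProbabilityMeasure μ]
      (F : ℕ → MeasurableSpace Ω), Monotone F → (∀ k, F k ≤ m) →
      ∀ (d : ℕ → Ω → ℝ) (δ : ℕ → ℝ) (β : ℝ), 0 < β → (∀ k, 0 < δ k) →
      (∀ k, Measurable[F (k + 1)] (d k)) →
      (∀ k, Integrable (d k) μ) →
      (∀ k s, MeasurableSet[F k] s → ∫ ω in s, d k ω ∂μ = 0) →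
      (∀ k, Integrable (fun ω => |d k ω| ^ p) μ) →
      (∀ k, ∫ ω, |d k ω| ^ p ∂μ ≤ δ k ^ p) → ∀ n : ℕ,
      Integrable (fun ω => |∑ k ∈ Finset.range n, d k ω| ^ p) μ ∧
      ∫ ω, |∑ k ∈ Finset.range n, d k ω| ^ p ∂μ
        ≤ (β + K * ∑ k ∈ Finset.range n, δ k ^ 2) ^ (p / 2) := by
  obtain ⟨C, hC1, hC⟩ := abs_add_rpow_le hp
  refine ⟨4 * C, by linarith, ?_⟩
  intro Ω m μ _ F hmono hF d δ β hβ hδ hmeas hint hmart hip hbd n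
  induction n with
  | zero =>
    have h0 : (0 : ℝ) ^ p = 0 := Real.zero_rpow (by linarith)
    simp only [Finset.range_zero, Finset.sum_empty, abs_zero, h0, mul_zero, add_zero]
    refine ⟨integrable_zero _ _ _, ?_⟩
    simp only [integral_zero]
    positivity
  | succ n ih =>
    obtain ⟨ihI, ih⟩ := ih
    set S : Ω → ℝ := fun ω => ∑ k ∈ Finset.range n, d k ω with hS
    set B : ℝ := β + 4 * C * ∑ k ∈ Finset.range n, δ k ^ 2 with hB
    have hBpos : 0 < B := by
      have : 0 ≤ ∑ k ∈ Finset.range n, δ k ^ 2 := Finset.sum_nonneg fun k _ => by positivity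
      positivity
    have hSm : Measurable[F n] S := by
      refine Finset.measurable_fun_sum _ fun k hk => ?_
      exact (hmeas k).mono (hmono (Finset.mem_range.1 hk)) le_rfl
    have hSm' : Measurable S := hSm.mono (hF n) le_rfl
    have hdm : Measurable (d n) := (hmeas n).mono (hF _) le_rfl
    have hδn := hδ n
    -- the linear term is `d n` times a function of the past, so it integrates to zero
    set g : Ω → ℝ := fun ω => |S ω| ^ (p - 2) * S ω with hg
    have hgm : Measurable[F n] g := by
      have : Measurable fun x : ℝ => |x| ^ (p - 2) * x := by fun_prop
      exact this.comp hSm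
    have hgI : Integrable (fun ω => g ω * d n ω) μ := by
      refine Integrable.mono' (ihI.add (hip n))
        ((hgm.mono (hF n) le_rfl).mul hdm).aestronglyMeasurable (ae_of_all _ fun ω => ?_)
      have h1 := rpow_mul_rpow_le_add (abs_nonneg (S ω)) (abs_nonneg (d n ω))
        (show 0 ≤ p - 1 by linarith) zero_le_one
      rw [Real.rpow_one, sub_add_cancel] at h1
      simp only [hg, Real.norm_eq_abs, abs_mul, Pi.add_apply]
      rw [abs_of_nonneg (Real.rpow_nonneg (abs_nonneg _) _)]
      have e : |S ω| ^ (p - 2) * |S ω| = |S ω| ^ (p - 1) := by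
        nth_rewrite 2 [← Real.rpow_one |S ω|]
        rw [← Real.rpow_add_of_nonneg (abs_nonneg _) (by linarith) zero_le_one]; congr 1; ring
      rw [e]; exact h1
    have hg0 : ∫ ω, g ω * d n ω ∂μ = 0 := by
      have hc : μ[d n | F n] =ᵐ[μ] 0 := by
        refine (ae_eq_condExp_of_forall_setIntegral_eq (hF n) (hint n) (fun s _ _ => integrableOn_zero)
          (fun s hs _ => ?_) aestronglyMeasurable_zero).symm
        rw [hmart n s hs]; simp
      have hm := condExp_mul_of_stronglyMeasurable_left (μ := μ) (hgm.stronglyMeasurable) hgI (hint n)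
      have := integral_condExp (hF n) (μ := μ) (f := g * d n)
      change ∫ ω, (g * d n) ω ∂μ = 0
      rw [← this, integral_congr_ae hm]
      refine integral_eq_zero_of_ae ?_
      filter_upwards [hc] with ω hω
      simp [hω]
    -- the quadratic term, with both factors normalised
    have hq : ∀ ω, |S ω| ^ (p - 2) * d n ω ^ 2 ≤
        B ^ (p / 2 - 1) * δ n ^ 2 * (|S ω| ^ p / B ^ (p / 2) + |d n ω| ^ p / δ n ^ p) := by
      intro ω
      have hsB : 0 < √B := Real.sqrt_pos.2 hBpos
      have h1 := rpow_mul_rpow_le_add (α := |S ω| / √B) (β := |d n ω| / δ n) (by positivity)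
        (by positivity) (show 0 ≤ p - 2 by linarith) zero_le_two
      rw [sub_add_cancel] at h1
      rw [Real.div_rpow (abs_nonneg _) hsB.le, Real.div_rpow (abs_nonneg _) hδn.le,
        Real.div_rpow (abs_nonneg _) hsB.le, Real.div_rpow (abs_nonneg _) hδn.le,
        Real.sqrt_eq_rpow, ← Real.rpow_mul hBpos.le, ← Real.rpow_mul hBpos.le] at h1
      rw [show 1 / 2 * (p - 2) = p / 2 - 1 by ring, show 1 / 2 * p = p / 2 by ring] at h1
      simp only [Real.rpow_two, sq_abs] at h1
      have h2 : 0 < B ^ (p / 2 - 1) * δ n ^ 2 := by positivity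
      have h3 := mul_le_mul_of_nonneg_left h1 h2.le
      refine le_trans (le_of_eq ?_) h3
      have : B ^ (p / 2 - 1) ≠ 0 := by positivity
      field_simp
    have hqI : Integrable (fun ω => |S ω| ^ (p - 2) * d n ω ^ 2) μ := by
      refine Integrable.mono' (((ihI.div_const (B ^ (p / 2))).add
        ((hip n).div_const (δ n ^ p))).const_mul (B ^ (p / 2 - 1) * δ n ^ 2))
        (by fun_prop) (ae_of_all _ fun ω => ?_)
      rw [Real.norm_eq_abs, abs_of_nonneg (by positivity)]
      exact hq ω
    have hqint : ∫ ω, |S ω| ^ (p - 2) * d n ω ^ 2 ∂μ ≤ 2 * (B ^ (p / 2 - 1) * δ n ^ 2) := by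
      refine (integral_mono hqI (((ihI.div_const (B ^ (p / 2))).add
        ((hip n).div_const (δ n ^ p))).const_mul (B ^ (p / 2 - 1) * δ n ^ 2)) hq).trans ?_
      rw [integral_const_mul]
      simp only [Pi.add_apply]
      rw [integral_add (ihI.div_const _) ((hip n).div_const _),
        integral_div, integral_div]
      have e1 : (∫ ω, |S ω| ^ p ∂μ) / B ^ (p / 2) ≤ 1 := (div_le_one (by positivity)).2 ih
      have e2 : (∫ ω, |d n ω| ^ p ∂μ) / δ n ^ p ≤ 1 := (div_le_one (by positivity)).2 (hbd n)
      have : 0 < B ^ (p / 2 - 1) * δ n ^ 2 := by positivity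
      nlinarith
    have hpt : ∀ ω, |∑ k ∈ Finset.range (n + 1), d k ω| ^ p ≤ |S ω| ^ p + p * (g ω * d n ω)
        + C * (|S ω| ^ (p - 2) * d n ω ^ 2 + |d n ω| ^ p) := by
      intro ω; rw [Finset.sum_range_succ]; exact hC _ _
    have hI1 : Integrable (fun ω => |S ω| ^ p + p * (g ω * d n ω)) μ := ihI.add (hgI.const_mul p)
    have hI2 : Integrable (fun ω => C * (|S ω| ^ (p - 2) * d n ω ^ 2 + |d n ω| ^ p)) μ :=
      (hqI.add (hip n)).const_mul C
    have hI : Integrable (fun ω => |S ω| ^ p + p * (g ω * d n ω)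
        + C * (|S ω| ^ (p - 2) * d n ω ^ 2 + |d n ω| ^ p)) μ := hI1.add hI2
    have hI' : Integrable (fun ω => |∑ k ∈ Finset.range (n + 1), d k ω| ^ p) μ := by
      refine Integrable.mono' hI ?_ (ae_of_all _ fun ω => ?_)
      · simp only [Finset.sum_range_succ]
        have : Measurable fun ω => |S ω + d n ω| ^ p := by fun_prop
        exact this.aestronglyMeasurable
      · rw [Real.norm_eq_abs, abs_of_nonneg (by positivity)]
        exact hpt ω
    refine ⟨hI', (integral_mono hI' hI hpt).trans ?_⟩
    rw [integral_add hI1 hI2, integral_add ihI (hgI.const_mul p), integral_const_mul,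
      integral_const_mul, hg0, integral_add hqI (hip n), mul_zero, add_zero, Finset.sum_range_succ]
    have hD : δ n ^ p = (δ n ^ 2) ^ (p / 2) := by
      rw [← Real.rpow_natCast, ← Real.rpow_mul hδn.le]; congr 1; push_cast; ring
    have hfin := rpow_add_mul_le (s := p / 2) (by linarith) (C := 2 * C) (K := 4 * C) (B := B)
      (D := δ n ^ 2) (by linarith) (by linarith) (by linarith) hBpos (by positivity)
    have e : β + 4 * C * (∑ k ∈ Finset.range n, δ k ^ 2 + δ n ^ 2) = B + 4 * C * δ n ^ 2 := by
      rw [hB]; ring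
    rw [e]
    refine le_trans ?_ hfin
    have h1 := hbd n
    rw [hD] at h1
    have h2 : 0 ≤ (δ n ^ 2) ^ (p / 2) := by positivity
    nlinarith

/-! ### Growth of products `∏ (1 + t_j f)` on generalized eigenspaces -/

section Growth

variable {E : Type*} [NormedAddCommGroup E] [NormedSpace ℂ E]

/-- The propagator `(1 + t_{k+m-1} f) ⋯ (1 + t_k f)` of the Euler scheme `x_{j+1} = x_j + t_j f x_j`,
over the `m` steps that start at time `k`. -/
noncomputable def eulerProp (f : Module.End ℂ E) (t : ℕ → ℝ) (k : ℕ) : ℕ → Module.End ℂ E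
  | 0 => 1
  | m + 1 => (1 + (t (k + m) : ℂ) • f) * eulerProp f t k m

/-- The orbit of `v` under the Euler propagators of `f` grows at most like `e^{β T} (1 + T)^ν`,
where `T` is the elapsed time, uniformly over schemes whose steps are bounded by `τ` and have sum of
squares at most `Q`. -/
def HasGrowth (f : Module.End ℂ E) (τ Q β : ℝ) (ν : ℕ) (v : E) : Prop :=
  ∃ C : ℝ, 0 ≤ C ∧ ∀ (t : ℕ → ℝ) (k m : ℕ), (∀ j, 0 ≤ t j) → (∀ j, t j ≤ τ) →
    ∑ i ∈ Finset.range m, t (k + i) ^ 2 ≤ Q →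
    ‖eulerProp f t k m v‖ ≤ C * Real.exp (β * ∑ i ∈ Finset.range m, t (k + i)) *
      (1 + ∑ i ∈ Finset.range m, t (k + i)) ^ ν

variable {f : Module.End ℂ E} {τ Q β : ℝ} {ν : ℕ} {v w : E}

theorem HasGrowth.zero : HasGrowth f τ Q β ν 0 :=
  ⟨0, le_rfl, fun t k m _ _ _ => by simp⟩

theorem HasGrowth.add (hv : HasGrowth f τ Q β ν v) (hw : HasGrowth f τ Q β ν w) :
    HasGrowth f τ Q β ν (v + w) := by
  obtain ⟨C, hC, h⟩ := hv
  obtain ⟨D, hD, h'⟩ := hw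
  refine ⟨C + D, by positivity, fun t k m h0 hτ hQ => ?_⟩
  rw [map_add, add_mul, add_mul]
  exact (norm_add_le _ _).trans (add_le_add (h t k m h0 hτ hQ) (h' t k m h0 hτ hQ))

theorem HasGrowth.sum {ι : Type*} (s : Finset ι) {g : ι → E}
    (h : ∀ i ∈ s, HasGrowth f τ Q β ν (g i)) : HasGrowth f τ Q β ν (∑ i ∈ s, g i) := by
  classical
  induction s using Finset.induction_on with
  | empty => simpa using HasGrowth.zero
  | insert a s ha ih =>
    rw [Finset.sum_insert ha]
    exact (h a (Finset.mem_insert_self _ _)).add (ih fun i hi => h i (Finset.mem_insert_of_mem hi))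

/-- A gap in the exponent absorbs every power of the elapsed time. -/
theorem HasGrowth.of_lt {μ : ℕ} {γ : ℝ} (h : HasGrowth f τ Q γ μ v) (hγ : γ < β) :
    HasGrowth f τ Q β ν v := by
  obtain ⟨C, hC, h⟩ := h
  have hδ : 0 < β - γ := sub_pos.2 hγ
  refine ⟨C * ((μ.factorial / (β - γ) ^ μ) * Real.exp (β - γ)), by positivity,
    fun t k m h0 hτ hQ => (h t k m h0 hτ hQ).trans ?_⟩
  set T := ∑ i ∈ Finset.range m, t (k + i) with hTdef
  have hT : 0 ≤ T := Finset.sum_nonneg fun i _ => h0 _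
  have h1 := Real.pow_div_factorial_le_exp (x := (β - γ) * (1 + T)) (by positivity) μ
  have h2 : (1 + T) ^ μ ≤ (μ.factorial / (β - γ) ^ μ) * Real.exp ((β - γ) * (1 + T)) := by
    rw [mul_pow] at h1
    rw [div_mul_eq_mul_div, le_div_iff₀ (by positivity)]
    rw [div_le_iff₀ (by positivity)] at h1
    linarith
  have h3 : (1 : ℝ) ≤ (1 + T) ^ ν := one_le_pow₀ (by linarith)
  have h4 : Real.exp (γ * T) * Real.exp ((β - γ) * (1 + T))
      = Real.exp (β - γ) * Real.exp (β * T) := by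
    rw [← Real.exp_add, ← Real.exp_add]; congr 1; ring
  calc C * Real.exp (γ * T) * (1 + T) ^ μ
      ≤ C * Real.exp (γ * T) * ((μ.factorial / (β - γ) ^ μ) * Real.exp ((β - γ) * (1 + T))) := by
        gcongr
    _ = C * (μ.factorial / (β - γ) ^ μ) *
        (Real.exp (γ * T) * Real.exp ((β - γ) * (1 + T))) := by ring
    _ = C * ((μ.factorial / (β - γ) ^ μ) * Real.exp (β - γ)) * Real.exp (β * T) * 1 := by
        rw [h4]; ring
    _ ≤ _ := by gcongr

theorem norm_one_add_ofReal_mul_le (z : ℂ) (t : ℝ) :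
    ‖1 + (t : ℂ) * z‖ ≤ Real.exp (z.re * t + ‖z‖ ^ 2 * t ^ 2 / 2) := by
  refine abs_le_of_sq_le_sq' ?_ (Real.exp_pos _).le |>.2
  rw [← Real.exp_nat_mul, Complex.sq_norm, Complex.normSq_apply, Complex.sq_norm,
    Complex.normSq_apply]
  refine le_trans (le_of_eq ?_) (Real.add_one_le_exp _)
  simp
  ring

/-- On a generalized eigenvector for `z`, killed by `(f - z) ^ (ν + 1)`, the propagators grow at
most like `e^{Re z T} (1 + T)^ν`. The components `(f - z) ^ i v` are estimated together. -/
theorem hasGrowth_of_pow_apply_eq_zero (hτ0 : 0 ≤ τ) {z : ℂ}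
    (hv : ((f - algebraMap ℂ _ z) ^ (ν + 1)) v = 0) : HasGrowth f τ Q z.re ν v := by
  set N : Module.End ℂ E := f - algebraMap ℂ _ z with hN
  set L : ℝ := ∑ i ∈ Finset.range (ν + 1), ‖(N ^ i) v‖ with hL
  have hL0 : 0 ≤ L := Finset.sum_nonneg fun i _ => norm_nonneg _
  set K : ℝ := Real.exp (|z.re| * τ) with hK
  have hK1 : 1 ≤ K := Real.one_le_exp (by positivity)
  set c : ℝ := ‖z‖ ^ 2 / 2 with hc
  have hc0 : 0 ≤ c := by positivity
  refine ⟨L * Real.exp (c * Q) * K ^ ν, by positivity, fun t k m h0 hτ hQ => ?_⟩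
  have hfN : f = N + algebraMap ℂ _ z := by rw [hN]; abel
  -- one step of the scheme maps the `i`-th component to a combination of itself and the next one
  have hstep : ∀ (i m : ℕ), (N ^ i) (eulerProp f t k (m + 1) v) =
      (1 + (t (k + m) : ℂ) * z) • (N ^ i) (eulerProp f t k m v)
        + (t (k + m) : ℂ) • (N ^ (i + 1)) (eulerProp f t k m v) := by
    intro i m
    set y := eulerProp f t k m v with hy
    have e1 : eulerProp f t k (m + 1) v = y + (t (k + m) : ℂ) • f y := by
      simp [eulerProp, hy]
    have e2 : f y = N y + z • y := by
      conv_lhs => rw [hfN]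
      simp [Module.algebraMap_end_apply]
    have e3 : (N ^ i) (N y) = (N ^ (i + 1)) y := by
      rw [pow_succ]; rfl
    rw [e1, e2, map_add, map_smul, map_add, map_smul, e3, add_smul, one_smul, smul_add, mul_smul]
    abel
  set T : ℕ → ℝ := fun m => ∑ i ∈ Finset.range m, t (k + i) with hT
  set R : ℕ → ℝ := fun m => ∑ i ∈ Finset.range m, t (k + i) ^ 2 with hR
  have hT0 : ∀ m, 0 ≤ T m := fun m => Finset.sum_nonneg fun i _ => h0 _
  have hT1 : ∀ m, T (m + 1) = T m + t (k + m) := fun m => Finset.sum_range_succ _ _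
  have hR1 : ∀ m, R (m + 1) = R m + t (k + m) ^ 2 := fun m => Finset.sum_range_succ _ _
  have hkill : ∀ m, (N ^ (ν + 1)) (eulerProp f t k m v) = 0 := by
    intro m
    induction m with
    | zero => simpa [eulerProp] using hv
    | succ m ih =>
      rw [hstep, ih, pow_succ' N (ν + 1), Module.End.mul_apply, ih]
      simp
  have key : ∀ (m i s : ℕ), i + s = ν → ‖(N ^ i) (eulerProp f t k m v)‖ ≤
      L * Real.exp (z.re * T m + c * R m) * (1 + K * T m) ^ s := by
    intro m
    induction m with
    | zero =>
      intro i s his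
      simp only [eulerProp, Module.End.one_apply, hT, hR, Finset.range_zero, Finset.sum_empty,
        mul_zero, add_zero, Real.exp_zero, mul_one, one_pow]
      exact Finset.single_le_sum (f := fun i => ‖(N ^ i) v‖) (fun i _ => norm_nonneg _)
        (Finset.mem_range.2 (by omega))
    | succ m ih =>
      intro i s his
      set τm := t (k + m) with hτm
      have ht0 : 0 ≤ τm := h0 _
      have htτ : τm ≤ τ := hτ _
      set ex := Real.exp (z.re * T m + c * R m) with hex
      have hTm := hT0 m
      have e1 : Real.exp (z.re * T (m + 1) + c * R (m + 1))
          = ex * Real.exp (z.re * τm + ‖z‖ ^ 2 * τm ^ 2 / 2) := by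
        rw [hex, ← Real.exp_add, hT1, hR1, hc]; congr 1; ring
      -- the constant `K` compensates for an exponential factor below one
      have e2 : 1 ≤ Real.exp (z.re * τm + ‖z‖ ^ 2 * τm ^ 2 / 2) * K := by
        rw [hK, ← Real.exp_add]
        refine Real.one_le_exp ?_
        have a1 : -|z.re| * τm ≤ z.re * τm := mul_le_mul_of_nonneg_right (neg_abs_le _) ht0
        have a2 : |z.re| * τm ≤ |z.re| * τ := mul_le_mul_of_nonneg_left htτ (abs_nonneg _)
        have a3 : 0 ≤ ‖z‖ ^ 2 * τm ^ 2 / 2 := by positivity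
        linarith
      have n1 := norm_one_add_ofReal_mul_le z τm
      set G := Real.exp (z.re * τm + ‖z‖ ^ 2 * τm ^ 2 / 2) with hG
      have hb1 : ‖(1 + (τm : ℂ) * z) • (N ^ i) (eulerProp f t k m v)‖
          ≤ G * (L * ex * (1 + K * T m) ^ s) := by
        rw [norm_smul]
        exact mul_le_mul n1 (ih i s his) (norm_nonneg _) (Real.exp_pos _).le
      have hb2 : ‖(τm : ℂ) • (N ^ (i + 1)) (eulerProp f t k m v)‖
          ≤ G * (L * ex * ((1 + K * T (m + 1)) ^ s - (1 + K * T m) ^ s)) := by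
        rcases s with _ | s
        · have : i = ν := by omega
          subst this
          rw [hkill]; simp
        · rw [norm_smul, Complex.norm_real, Real.norm_eq_abs, abs_of_nonneg ht0]
          have h5 : τm * ‖(N ^ (i + 1)) (eulerProp f t k m v)‖
              ≤ τm * (L * ex * (1 + K * T m) ^ s) :=
            mul_le_mul_of_nonneg_left (ih (i + 1) s (by omega)) ht0
          have h6 : K * τm * (1 + K * T m) ^ s
              ≤ (1 + K * T (m + 1)) ^ (s + 1) - (1 + K * T m) ^ (s + 1) := by
            have h7 : (1 + K * T m) ^ s ≤ (1 + K * T (m + 1)) ^ s := by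
              rw [hT1]; gcongr; linarith
            have h8 : 0 ≤ 1 + K * T (m + 1) := by
              have := hT0 (m + 1); positivity
            have h9 := mul_le_mul_of_nonneg_right h7 h8
            have h13 : (1 + K * T m) ^ s * (1 + K * T (m + 1))
                = (1 + K * T m) ^ s * (1 + K * T m) + K * τm * (1 + K * T m) ^ s := by
              rw [hT1]; ring
            rw [pow_succ, pow_succ]
            linarith
          have h10 : 0 ≤ L * ex := by positivity
          have h11 : τm * (1 + K * T m) ^ s ≤ G * (K * τm * (1 + K * T m) ^ s) := by
            have h12 : 0 ≤ τm * (1 + K * T m) ^ s := by positivity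
            nlinarith [mul_le_mul_of_nonneg_right e2 h12]
          calc _ ≤ τm * (L * ex * (1 + K * T m) ^ s) := h5
            _ = L * ex * (τm * (1 + K * T m) ^ s) := by ring
            _ ≤ L * ex * (G * (K * τm * (1 + K * T m) ^ s)) := by gcongr
            _ ≤ L * ex * (G * ((1 + K * T (m + 1)) ^ (s + 1) - (1 + K * T m) ^ (s + 1))) := by
              gcongr
            _ = _ := by ring
      rw [hstep, e1]
      refine (norm_add_le _ _).trans ((add_le_add hb1 hb2).trans (le_of_eq ?_))
      ring
  have h1 := key m 0 ν (by omega)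
  rw [pow_zero, Module.End.one_apply] at h1
  refine h1.trans ?_
  have hTm := hT0 m
  have h2 : (1 + K * T m) ^ ν ≤ K ^ ν * (1 + T m) ^ ν := by
    rw [← mul_pow]; gcongr; nlinarith
  calc L * Real.exp (z.re * T m + c * R m) * (1 + K * T m) ^ ν
      ≤ L * Real.exp (z.re * T m + c * Q) * (K ^ ν * (1 + T m) ^ ν) := by gcongr
    _ = _ := by rw [Real.exp_add]; ring

end Growth

/-! ### Growth on the kernel of a left eigenvector -/

section Spectral

variable {E : Type*} [NormedAddCommGroup E] [NormedSpace ℂ E]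

/-- A left eigenvector for `b` vanishes on the generalized eigenspaces of all other eigenvalues. -/
theorem apply_eq_zero_of_mem_maxGenEigenspace {f : Module.End ℂ E} {α : E →ₗ[ℂ] ℂ} {b : ℂ}
    (hα : ∀ x, α (f x) = b * α x) {z : ℂ} (hz : z ≠ b) {x : E}
    (hx : x ∈ f.maxGenEigenspace z) : α x = 0 := by
  obtain ⟨k, hk⟩ := Module.End.mem_maxGenEigenspace _ _ _ |>.1 hx
  have : ∀ k (x : E), α (((f - z • (1 : Module.End ℂ E)) ^ k) x) = (b - z) ^ k * α x := by
    intro k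
    induction k with
    | zero => simp
    | succ k ih =>
      intro x
      rw [pow_succ, Module.End.mul_apply, ih]
      simp [hα]; ring
  have h := this k x
  rw [hk, map_zero] at h
  have h' : (b - z) ^ k ≠ 0 := pow_ne_zero _ (sub_ne_zero.2 hz.symm)
  exact (mul_eq_zero.1 h.symm).resolve_left h'

/-- If `α ≠ 0` is a left eigenvector of `f` for `b`, and the generalized eigenspace of `b` contains
a nonzero vector killed by `α`, then `b` has algebraic multiplicity at least two. -/
theorem two_le_rootMultiplicity [FiniteDimensional ℂ E] {f : Module.End ℂ E} {α : E →ₗ[ℂ] ℂ} {b : ℂ}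
    (hα : ∀ x, α (f x) = b * α x) (hα0 : α ≠ 0) {v : E} (hv : v ∈ f.maxGenEigenspace b)
    (hv0 : v ≠ 0) (hαv : α v = 0) : 2 ≤ f.charpoly.rootMultiplicity b := by
  rw [← LinearMap.finrank_maxGenEigenspace_eq]
  obtain ⟨w, hw⟩ : ∃ w ∈ f.maxGenEigenspace b, α w ≠ 0 := by
    by_contra! hcon
    apply hα0
    have : ∀ x : E, x ∈ LinearMap.ker α := by
      have hle : (⨆ z, f.maxGenEigenspace z) ≤ LinearMap.ker α := by
        refine iSup_le fun z x hx => ?_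
        rcases eq_or_ne z b with rfl | hz
        · exact hcon x hx
        · exact apply_eq_zero_of_mem_maxGenEigenspace hα hz hx
      rw [Module.End.iSup_maxGenEigenspace_eq_top] at hle
      exact fun x => hle trivial
    ext x; exact this x
  have hli : LinearIndependent ℂ ![(⟨v, hv⟩ : f.maxGenEigenspace b), ⟨w, hw.1⟩] := by
    rw [LinearIndependent.pair_iff]
    intro s t hst
    have h1 : s • v + t • w = 0 := congrArg Subtype.val hst
    have h2 := congrArg α h1
    simp [hαv, hw.2] at h2
    subst h2
    simpa [hv0] using h1
  simpa using hli.fintype_card_le_finrank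

/-- **Growth on the kernel of a left eigenvector.** If `α` is a left eigenvector of `f` for the
eigenvalue `ev 0 = b`, then on `ker α` only the remaining eigenvalues `ev 1, ev 2, …` matter. -/
theorem hasGrowth_of_left_eigenvector [FiniteDimensional ℂ E] {f : Module.End ℂ E}
    {α : E →ₗ[ℂ] ℂ} {b : ℂ} (hα : ∀ x, α (f x) = b * α x) (hα0 : α ≠ 0) {q : ℕ} {ev : Fin q → ℂ}
    (hroots : f.charpoly.roots = Finset.univ.val.map ev) (hfirst : ∀ i : Fin q, i.val = 0 → ev i = b)
    {τ Q β : ℝ} (hτ0 : 0 ≤ τ) {ν : ℕ}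
    (hev : ∀ i : Fin q, 1 ≤ i.val → (ev i).re < β ∨ ((ev i).re = β ∧
      ∀ v ∈ f.maxGenEigenspace (ev i), ((f - algebraMap ℂ _ (ev i)) ^ (ν + 1)) v = 0))
    {v : E} (hv : α v = 0) : HasGrowth f τ Q β ν v := by
  have hmem : v ∈ ⨆ z, f.maxGenEigenspace z := by
    rw [Module.End.iSup_maxGenEigenspace_eq_top]; trivial
  obtain ⟨g, hg, rfl⟩ := (Submodule.mem_iSup_iff_exists_finsupp _ _).1 hmem
  have hgb : α (g b) = 0 := by
    rw [Finsupp.sum, map_sum] at hv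
    by_cases hb : b ∈ g.support
    · rw [Finset.sum_eq_single_of_mem b hb] at hv
      · exact hv
      · exact fun z _ hz => apply_eq_zero_of_mem_maxGenEigenspace hα hz (hg z)
    · rw [Finsupp.notMem_support_iff.1 hb, map_zero]
  refine HasGrowth.sum _ fun z hz => ?_
  have hgz : g z ≠ 0 := Finsupp.mem_support_iff.1 hz
  obtain ⟨i, hi1, rfl⟩ : ∃ i : Fin q, 1 ≤ i.val ∧ ev i = z := by
    rcases eq_or_ne z b with rfl | hzb
    · have h2 := two_le_rootMultiplicity hα hα0 (hg z) hgz hgb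
      rw [← Polynomial.count_roots, hroots, Multiset.count_map] at h2
      have h3 : 1 < (Finset.univ.filter fun i => z = ev i).card := h2
      obtain ⟨i, hi, j, hj, hij⟩ := Finset.one_lt_card.1 h3
      simp only [Finset.mem_filter, Finset.mem_univ, true_and] at hi hj
      rcases Nat.eq_zero_or_pos i.val with h | h
      · refine ⟨j, ?_, hj.symm⟩
        rcases Nat.eq_zero_or_pos j.val with h' | h'
        · exact absurd (Fin.ext (h.trans h'.symm)) hij
        · exact h'
      · exact ⟨i, h, hi.symm⟩
    · have hr : z ∈ f.charpoly.roots := by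
        rw [← Multiset.count_pos, Polynomial.count_roots, ← LinearMap.finrank_maxGenEigenspace_eq]
        have : Nontrivial (f.maxGenEigenspace z) :=
          ⟨⟨g z, hg z⟩, 0, fun h => hgz (congrArg Subtype.val h)⟩
        exact Module.finrank_pos
      rw [hroots] at hr
      obtain ⟨i, _, hi⟩ := Multiset.mem_map.1 hr
      refine ⟨i, ?_, hi⟩
      rcases Nat.eq_zero_or_pos i.val with h | h
      · exact absurd (hi.symm.trans (hfirst i h)) hzb
      · exact h
  have hgen : HasGrowth f τ Q (ev i).re (Module.finrank ℂ E) (g (ev i)) := by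
    refine hasGrowth_of_pow_apply_eq_zero hτ0 ?_
    have h1 := hg (ev i)
    rw [Module.End.maxGenEigenspace_eq_genEigenspace_finrank, Module.End.mem_genEigenspace_nat] at h1
    rw [pow_succ', Module.End.mul_apply, Algebra.algebraMap_eq_smul_one, LinearMap.mem_ker.1 h1,
      map_zero]
  rcases hev i hi1 with h | ⟨h, h'⟩
  · exact hgen.of_lt h
  · rw [← h]
    exact hasGrowth_of_pow_apply_eq_zero hτ0 (h' _ (hg _))

end Spectral

/-! ### Elementary sums -/

theorem sum_one_div_le_log {k : ℕ} (hk : 1 ≤ k) (m : ℕ) :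
    ∑ i ∈ Finset.range m, 1 / ((k : ℝ) + i) ≤ 1 + Real.log (((k : ℝ) + m) / k) := by
  have hk0 : (1 : ℝ) ≤ k := by exact_mod_cast hk
  have key : ∑ i ∈ Finset.range m, 1 / ((k : ℝ) + i)
      ≤ 1 / (k : ℝ) - 1 / ((k : ℝ) + m) + Real.log (((k : ℝ) + m) / k) := by
    induction m with
    | zero =>
      have : (k : ℝ) / k = 1 := div_self (by positivity)
      simp [this]
    | succ m ih =>
      rw [Finset.sum_range_succ]
      have h1 := Real.one_sub_inv_le_log_of_pos
        (show (0 : ℝ) < (k + m + 1) / (k + m) by positivity)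
      have h2 : Real.log (((k : ℝ) + (m + 1 : ℕ)) / k)
          = Real.log (((k : ℝ) + m) / k) + Real.log ((k + m + 1) / (k + m)) := by
        rw [← Real.log_mul (by positivity) (by positivity)]
        congr 1
        push_cast
        field_simp
        ring
      have h3 : 1 - (((k : ℝ) + m + 1) / (k + m))⁻¹ = 1 / (k + m + 1) := by
        field_simp; ring
      rw [h3] at h1
      have h4 : (k : ℝ) + (m + 1 : ℕ) = k + m + 1 := by push_cast; ring
      rw [h2, h4]
      linarith
  have h1 : 1 / (k : ℝ) ≤ 1 := by rw [div_le_one (by positivity)]; exact hk0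
  have h2 : 0 ≤ 1 / ((k : ℝ) + m) := by positivity
  linarith

theorem sum_rpow_neg_le_of_one_lt {s : ℝ} (hs : 1 < s) :
    ∃ C : ℝ, 0 ≤ C ∧ ∀ n : ℕ, ∑ k ∈ Finset.range n, ((k : ℝ) + 1) ^ (-s) ≤ C := by
  have h : Summable fun k : ℕ => ((k : ℝ) + 1) ^ (-s) := by
    have := (summable_nat_add_iff 1).2 (Real.summable_nat_rpow.2 (show -s < -1 by linarith))
    simpa using this
  exact ⟨_, tsum_nonneg fun k => by positivity, fun n => h.sum_le_tsum _ fun k _ => by positivity⟩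

theorem sum_rpow_neg_one_le (n : ℕ) :
    ∑ k ∈ Finset.range n, ((k : ℝ) + 1) ^ (-1 : ℝ) ≤ 1 + Real.log n := by
  have := harmonic_le_one_add_log n
  simpa [harmonic, Real.rpow_neg_one] using this

theorem sum_rpow_neg_le_of_lt_one {s : ℝ} (hs0 : 0 ≤ s) (hs : s < 1) (n : ℕ) :
    ∑ k ∈ Finset.range n, ((k : ℝ) + 1) ^ (-s) ≤ 1 / (1 - s) * (n : ℝ) ^ (1 - s) := by
  have h1s : 0 < 1 - s := by linarith
  induction n with
  | zero => simp [Real.zero_rpow h1s.ne']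
  | succ n ih =>
    rw [Finset.sum_range_succ]
    have hn : (0 : ℝ) < n + 1 := by positivity
    have h1 := rpow_one_add_le_one_add_mul_self (s := -(1 / ((n : ℝ) + 1))) (p := 1 - s)
      (by rw [neg_le_neg_iff, div_le_one hn]; linarith [(Nat.cast_nonneg n : (0 : ℝ) ≤ n)])
      h1s.le (by linarith)
    have h2 : 1 + -(1 / ((n : ℝ) + 1)) = n / (n + 1) := by field_simp; ring
    rw [h2, Real.div_rpow (by positivity) hn.le, div_le_iff₀ (by positivity)] at h1
    have h3 : ((n : ℝ) + 1) ^ (1 - s) = (n + 1) * ((n : ℝ) + 1) ^ (-s) := by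
      rw [sub_eq_add_neg, Real.rpow_add hn, Real.rpow_one]
    have h4 : (1 + (1 - s) * -(1 / ((n : ℝ) + 1))) * ((n : ℝ) + 1) ^ (1 - s)
        = ((n : ℝ) + 1) ^ (1 - s) - (1 - s) * ((n : ℝ) + 1) ^ (-s) := by
      rw [h3]; field_simp; ring
    rw [h4] at h1
    push_cast
    have h5 : ((n : ℝ) + 1) ^ (-s)
        ≤ 1 / (1 - s) * (((n : ℝ) + 1) ^ (1 - s) - (n : ℝ) ^ (1 - s)) := by
      rw [div_mul_eq_mul_div, one_mul, le_div_iff₀ h1s]; linarith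
    have h6 : 1 / (1 - s) * (((n : ℝ) + 1) ^ (1 - s) - (n : ℝ) ^ (1 - s))
      = 1 / (1 - s) * ((n : ℝ) + 1) ^ (1 - s) - 1 / (1 - s) * (n : ℝ) ^ (1 - s) := by ring
    linarith

/-- The order of magnitude of the effect at time `n` of a unit perturbation made at step `k`. -/
noncomputable def stepWeight (r : ℝ) (ν n k : ℕ) : ℝ :=
  ((n : ℝ) / (k + 1)) ^ r * (1 + Real.log n) ^ ν

/-- `rate` controls the accumulated effect at time `n` of perturbations that are
orthogonal and of order one (the martingale part) or of order `(k + 1) ^ (-1 / 2)` (the drift part),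
for weights `stepWeight r ν n k`; and it is at least of order `n ^ (1 / 2)`. -/
def IsRate (r : ℝ) (ν : ℕ) (rate : ℕ → ℝ) : Prop :=
  ∃ C : ℝ, 0 ≤ C ∧ ∀ n : ℕ, 2 ≤ n → 0 ≤ rate n ∧
    (n : ℝ) ^ (1 / 2 : ℝ) ≤ C * rate n ∧
    ∑ k ∈ Finset.range n, stepWeight r ν n k ^ 2 ≤ (C * rate n) ^ 2 ∧
    ∑ k ∈ Finset.range n, stepWeight r ν n k * ((k : ℝ) + 1) ^ (-(1 / 2) : ℝ) ≤ C * rate n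

theorem sum_stepWeight_sq (r : ℝ) (ν n : ℕ) :
    ∑ k ∈ Finset.range n, stepWeight r ν n k ^ 2
      = ((n : ℝ) ^ r * (1 + Real.log n) ^ ν) ^ 2 *
        ∑ k ∈ Finset.range n, ((k : ℝ) + 1) ^ (-(2 * r)) := by
  rw [Finset.mul_sum]
  refine Finset.sum_congr rfl fun k _ => ?_
  have hk : (0 : ℝ) ≤ (k : ℝ) + 1 := by positivity
  rw [stepWeight, Real.div_rpow (Nat.cast_nonneg n) hk, Real.rpow_neg hk, mul_comm 2 r,
    Real.rpow_mul hk, Real.rpow_two]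
  ring

theorem sum_stepWeight_mul (r : ℝ) (ν n : ℕ) :
    ∑ k ∈ Finset.range n, stepWeight r ν n k * ((k : ℝ) + 1) ^ (-(1 / 2) : ℝ)
      = ((n : ℝ) ^ r * (1 + Real.log n) ^ ν) *
        ∑ k ∈ Finset.range n, ((k : ℝ) + 1) ^ (-(r + 1 / 2)) := by
  rw [Finset.mul_sum]
  refine Finset.sum_congr rfl fun k _ => ?_
  have hk : (0 : ℝ) < (k : ℝ) + 1 := by positivity
  rw [stepWeight, Real.div_rpow (Nat.cast_nonneg n) hk.le, neg_add, Real.rpow_add hk,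
    Real.rpow_neg hk.le r]
  ring

theorem one_add_log_le {n : ℕ} (hn : 2 ≤ n) : 1 + Real.log n ≤ 3 * Real.log n := by
  have h1 : Real.log 2 ≤ Real.log n := Real.log_le_log (by norm_num) (by exact_mod_cast hn)
  have := Real.log_two_gt_d9
  linarith

theorem isRate_of_lt_half {r : ℝ} (hr0 : 0 ≤ r) (hr : r < 1 / 2) :
    IsRate r 0 fun n => (n : ℝ) ^ (1 / 2 : ℝ) := by
  have h1 : 0 < 1 - 2 * r := by linarith
  have h2 : 0 < 1 - (r + 1 / 2) := by linarith
  refine ⟨1 + 1 / (1 - 2 * r) + 1 / (1 - (r + 1 / 2)), by positivity, fun n hn => ?_⟩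
  have hn0 : (0 : ℝ) < n := by exact_mod_cast (by omega : 0 < n)
  have hD1 : 0 < 1 / (1 - 2 * r) := by positivity
  have hD2 : 0 < 1 / (1 - (r + 1 / 2)) := by positivity
  have hR : 0 < (n : ℝ) ^ (1 / 2 : ℝ) := by positivity
  refine ⟨hR.le, by nlinarith, ?_, ?_⟩
  · rw [sum_stepWeight_sq, pow_zero, mul_one]
    have h3 := sum_rpow_neg_le_of_lt_one (s := 2 * r) (by linarith) (by linarith) n
    have h4 : ((n : ℝ) ^ r) ^ 2 * (n : ℝ) ^ (1 - 2 * r) = ((n : ℝ) ^ (1 / 2 : ℝ)) ^ 2 := by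
      rw [← Real.rpow_two, ← Real.rpow_two, ← Real.rpow_mul hn0.le, ← Real.rpow_mul hn0.le,
        ← Real.rpow_add hn0]
      congr 1; ring
    calc ((n : ℝ) ^ r) ^ 2 * ∑ k ∈ Finset.range n, ((k : ℝ) + 1) ^ (-(2 * r))
        ≤ ((n : ℝ) ^ r) ^ 2 * (1 / (1 - 2 * r) * (n : ℝ) ^ (1 - 2 * r)) := by gcongr
      _ = 1 / (1 - 2 * r) * ((n : ℝ) ^ (1 / 2 : ℝ)) ^ 2 := by rw [← h4]; ring
      _ ≤ _ := by
        rw [mul_pow]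
        gcongr
        nlinarith
  · rw [sum_stepWeight_mul, pow_zero, mul_one]
    have h3 := sum_rpow_neg_le_of_lt_one (s := r + 1 / 2) (by linarith) (by linarith) n
    have h4 : (n : ℝ) ^ r * (n : ℝ) ^ (1 - (r + 1 / 2)) = (n : ℝ) ^ (1 / 2 : ℝ) := by
      rw [← Real.rpow_add hn0]
      congr 1; ring
    calc (n : ℝ) ^ r * ∑ k ∈ Finset.range n, ((k : ℝ) + 1) ^ (-(r + 1 / 2))
        ≤ (n : ℝ) ^ r * (1 / (1 - (r + 1 / 2)) * (n : ℝ) ^ (1 - (r + 1 / 2))) := by gcongr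
      _ = 1 / (1 - (r + 1 / 2)) * (n : ℝ) ^ (1 / 2 : ℝ) := by rw [← h4]; ring
      _ ≤ _ := by gcongr; linarith

theorem isRate_of_eq_half (ν : ℕ) :
    IsRate (1 / 2) ν fun n => (n : ℝ) ^ (1 / 2 : ℝ) * Real.log n ^ (ν + 1) := by
  refine ⟨3 ^ (ν + 1), by positivity, fun n hn => ?_⟩
  have hn0 : (0 : ℝ) < n := by exact_mod_cast (by omega : 0 < n)
  have hlog : 0 ≤ Real.log n := Real.log_natCast_nonneg n
  have hR : 0 < (n : ℝ) ^ (1 / 2 : ℝ) := by positivity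
  have hL := one_add_log_le hn
  have hmain : (n : ℝ) ^ (1 / 2 : ℝ) * (1 + Real.log n) ^ (ν + 1)
      ≤ 3 ^ (ν + 1) * ((n : ℝ) ^ (1 / 2 : ℝ) * Real.log n ^ (ν + 1)) := by
    have : (1 + Real.log n) ^ (ν + 1) ≤ 3 ^ (ν + 1) * Real.log n ^ (ν + 1) := by
      rw [← mul_pow]; gcongr
    calc _ ≤ (n : ℝ) ^ (1 / 2 : ℝ) * (3 ^ (ν + 1) * Real.log n ^ (ν + 1)) := by gcongr
      _ = _ := by ring
  have h1L : 1 ≤ 1 + Real.log n := by linarith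
  refine ⟨by positivity, le_trans ?_ hmain, ?_, le_trans ?_ hmain⟩
  · exact le_mul_of_one_le_right hR.le (one_le_pow₀ h1L)
  · refine le_trans ?_ (pow_le_pow_left₀ (by positivity) hmain 2)
    rw [sum_stepWeight_sq]
    norm_num only
    calc ((n : ℝ) ^ (1 / 2 : ℝ) * (1 + Real.log n) ^ ν) ^ 2 *
          ∑ k ∈ Finset.range n, ((k : ℝ) + 1) ^ (-1 : ℝ)
        ≤ ((n : ℝ) ^ (1 / 2 : ℝ) * (1 + Real.log n) ^ ν) ^ 2 * (1 + Real.log n) ^ 2 := by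
          gcongr
          exact (sum_rpow_neg_one_le n).trans (by nlinarith)
      _ = _ := by ring
  · rw [sum_stepWeight_mul]
    norm_num only
    calc ((n : ℝ) ^ (1 / 2 : ℝ) * (1 + Real.log n) ^ ν) *
          ∑ k ∈ Finset.range n, ((k : ℝ) + 1) ^ (-1 : ℝ)
        ≤ ((n : ℝ) ^ (1 / 2 : ℝ) * (1 + Real.log n) ^ ν) * (1 + Real.log n) := by
          gcongr
          exact sum_rpow_neg_one_le n
      _ = _ := by ring

theorem isRate_of_half_lt {r : ℝ} (hr : 1 / 2 < r) (ν : ℕ) :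
    IsRate r ν fun n => (n : ℝ) ^ r * Real.log n ^ ν := by
  obtain ⟨C₁, hC₁, h₁⟩ := sum_rpow_neg_le_of_one_lt (s := 2 * r) (by linarith)
  obtain ⟨C₂, hC₂, h₂⟩ := sum_rpow_neg_le_of_one_lt (s := r + 1 / 2) (by linarith)
  refine ⟨(1 + C₁ + C₂) * 3 ^ ν, by positivity, fun n hn => ?_⟩
  have hn0 : (0 : ℝ) < n := by exact_mod_cast (by omega : 0 < n)
  have hn1 : (1 : ℝ) ≤ n := by exact_mod_cast (by omega : 1 ≤ n)
  have hlog : 0 ≤ Real.log n := Real.log_natCast_nonneg n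
  have hR : 0 < (n : ℝ) ^ r := by positivity
  have hL := one_add_log_le hn
  have hmain : (n : ℝ) ^ r * (1 + Real.log n) ^ ν
      ≤ 3 ^ ν * ((n : ℝ) ^ r * Real.log n ^ ν) := by
    have : (1 + Real.log n) ^ ν ≤ 3 ^ ν * Real.log n ^ ν := by
      rw [← mul_pow]; gcongr
    calc _ ≤ (n : ℝ) ^ r * (3 ^ ν * Real.log n ^ ν) := by gcongr
      _ = _ := by ring
  have h1L : 1 ≤ 1 + Real.log n := by linarith
  have hY : 0 ≤ (n : ℝ) ^ r * Real.log n ^ ν := by positivity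
  set W := (n : ℝ) ^ r * (1 + Real.log n) ^ ν with hW
  have hW0 : 0 ≤ W := by positivity
  refine ⟨hY, ?_, ?_, ?_⟩
  · calc (n : ℝ) ^ (1 / 2 : ℝ) ≤ (n : ℝ) ^ r := Real.rpow_le_rpow_of_exponent_le hn1 hr.le
      _ ≤ W := le_mul_of_one_le_right hR.le (one_le_pow₀ h1L)
      _ ≤ 1 * 3 ^ ν * ((n : ℝ) ^ r * Real.log n ^ ν) := by rw [one_mul]; exact hmain
      _ ≤ _ := by gcongr; linarith
  · rw [sum_stepWeight_sq]
    calc W ^ 2 * ∑ k ∈ Finset.range n, ((k : ℝ) + 1) ^ (-(2 * r))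
        ≤ (3 ^ ν * ((n : ℝ) ^ r * Real.log n ^ ν)) ^ 2 * C₁ := by
          gcongr
          exact h₁ n
      _ ≤ (3 ^ ν * ((n : ℝ) ^ r * Real.log n ^ ν)) ^ 2 * (1 + C₁ + C₂) ^ 2 := by
          gcongr
          nlinarith
      _ = _ := by ring
  · rw [sum_stepWeight_mul]
    calc W * ∑ k ∈ Finset.range n, ((k : ℝ) + 1) ^ (-(r + 1 / 2))
        ≤ (3 ^ ν * ((n : ℝ) ^ r * Real.log n ^ ν)) * C₂ := by
          gcongr
          exact h₂ n
      _ ≤ (3 ^ ν * ((n : ℝ) ^ r * Real.log n ^ ν)) * (1 + C₁ + C₂) := by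
          gcongr
          linarith
      _ = _ := by ring

namespace PolyaUrn

variable {q : ℕ} (U : PolyaUrn q)

/-! ### The intensity matrix as an endomorphism -/

/-- The intensity matrix as an endomorphism of `ℂ^q`. -/
noncomputable def intensityEnd : Module.End ℂ (Fin q → ℂ) := Matrix.toLinAlgEquiv' U.intensityMatrixC

/-- The expectation `E ξ_{j,l}`. -/
noncomputable def meanReplacement (j l : Fin q) : ℝ := ∫ x, x l ∂(U.replacement j)

/-- The total activity `a · x` as a linear functional on `ℂ^q`. -/
noncomputable def activityFunctional : (Fin q → ℂ) →ₗ[ℂ] ℂ where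
  toFun x := ∑ i, (U.activity i : ℂ) * x i
  map_add' x y := by simp [mul_add, Finset.sum_add_distrib]
  map_smul' c x := by simp [Finset.mul_sum, mul_left_comm]

variable {U}

/-- Balance in expectation says that the activities form a left eigenvector of the intensity matrix
for `b`. -/
theorem sum_activity_mul_mean {b : ℝ} (hbal : U.BalancedInExpectation b) (j : Fin q) :
    ∑ i, U.activity i * (U.activity j * U.meanReplacement j i) = b * U.activity j := by
  rcases (U.activity_nonneg j).eq_or_lt with h | h
  · simp [← h]
  · rw [← hbal.2 j h, Finset.sum_mul]
    exact Finset.sum_congr rfl fun i _ => by rw [meanReplacement]; ring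

theorem activityFunctional_intensityEnd {b : ℝ} (hbal : U.BalancedInExpectation b)
    (x : Fin q → ℂ) :
    U.activityFunctional (U.intensityEnd x) = (b : ℂ) * U.activityFunctional x := by
  simp only [activityFunctional, intensityEnd, LinearMap.coe_mk, AddHom.coe_mk,
    Matrix.toLinAlgEquiv'_apply, Matrix.mulVec, dotProduct, Finset.mul_sum]
  rw [Finset.sum_comm]
  refine Finset.sum_congr rfl fun j _ => ?_
  have := congrArg (fun r : ℝ => (r : ℂ)) (sum_activity_mul_mean hbal j)
  push_cast at this
  rw [← mul_assoc, ← this, Finset.sum_mul]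
  refine Finset.sum_congr rfl fun i _ => ?_
  simp [intensityMatrixC, intensityMatrix, meanReplacement]
  ring

theorem exists_activity_pos : ∃ i, 0 < U.activity i := by
  by_contra! h
  have := U.init_activity_pos
  have h0 : ∀ i, U.activity i = 0 := fun i => le_antisymm (h i) (U.activity_nonneg i)
  simp [h0] at this

theorem activityFunctional_ne_zero : U.activityFunctional ≠ 0 := by
  obtain ⟨i, hi⟩ := U.exists_activity_pos
  intro h
  have := congrArg (fun φ => φ (Pi.single i 1)) h
  simp [activityFunctional, Pi.single_apply] at this
  exact hi.ne' this

theorem intensityEnd_sub_pow_apply (z : ℂ) (k : ℕ) (v : Fin q → ℂ) :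
    ((U.intensityEnd - algebraMap ℂ _ z) ^ k) v
      = ((U.intensityMatrixC - Matrix.scalar (Fin q) z) ^ k).mulVec v := by
  rw [← Matrix.toLinAlgEquiv'_apply, map_pow, map_sub, intensityEnd]
  congr 3
  rw [← AlgEquiv.commutes Matrix.toLinAlgEquiv' z]
  rfl

/-- The infimum defining `ν_z` is attained, so `(A - z) ^ (ν_z + 1)` kills the generalized
eigenspace of `z`. -/
theorem intensityEnd_sub_pow_nu_apply {z : ℂ} {v : Fin q → ℂ}
    (hv : v ∈ U.intensityEnd.maxGenEigenspace z) {ν : ℕ} (hν : U.nu z ≤ ν) :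
    ((U.intensityEnd - algebraMap ℂ _ z) ^ (ν + 1)) v = 0 := by
  have hmem : ∀ (v : Fin q → ℂ) (k : ℕ), ((U.intensityEnd - algebraMap ℂ _ z) ^ k) v = 0 →
      v ∈ U.intensityEnd.maxGenEigenspace z := by
    intro v k hk
    rw [Module.End.mem_maxGenEigenspace]
    rw [Algebra.algebraMap_eq_smul_one] at hk
    exact ⟨k, hk⟩
  have hne : {k : ℕ | ∀ v : Fin q → ℂ,
      (∃ m : ℕ, ((U.intensityMatrixC - Matrix.scalar (Fin q) z) ^ m).mulVec v = 0) →
      ((U.intensityMatrixC - Matrix.scalar (Fin q) z) ^ (k + 1)).mulVec v = 0}.Nonempty := by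
    refine ⟨Module.finrank ℂ (Fin q → ℂ), fun v ⟨m, hm⟩ => ?_⟩
    rw [← intensityEnd_sub_pow_apply] at hm ⊢
    have h1 := hmem v m hm
    rw [Module.End.maxGenEigenspace_eq_genEigenspace_finrank,
      Module.End.mem_genEigenspace_nat] at h1
    rw [pow_succ', Module.End.mul_apply, Algebra.algebraMap_eq_smul_one, LinearMap.mem_ker.1 h1,
      map_zero]
  have h := Nat.sInf_mem hne v
  rw [Module.End.mem_maxGenEigenspace] at hv
  obtain ⟨m, hm⟩ := hv
  rw [← Algebra.algebraMap_eq_smul_one, intensityEnd_sub_pow_apply] at hm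
  have h1 := h ⟨m, hm⟩
  rw [← intensityEnd_sub_pow_apply] at h1
  obtain ⟨d, rfl⟩ := Nat.exists_eq_add_of_le hν
  rw [show U.nu z + d + 1 = d + (U.nu z + 1) by ring, pow_add, Module.End.mul_apply]
  unfold nu
  rw [h1, map_zero]

theorem hasGrowth_intensityEnd (hq : 2 ≤ q) {b : ℝ} (hbal : U.BalancedInExpectation b)
    {ev : Fin q → ℂ} (hev : U.IsEigenvalueLabelling b ev) {τ Q : ℝ} (hτ : 0 ≤ τ) {v : Fin q → ℂ}
    (hv : U.activityFunctional v = 0) :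
    HasGrowth U.intensityEnd τ Q (ev ⟨1, hq⟩).re (U.nu (ev ⟨1, hq⟩)) v := by
  have hroots : U.intensityEnd.charpoly.roots = Finset.univ.val.map ev := by
    rw [← hev.roots_eq]
    congr 1
    exact Matrix.charpoly_toLin' _
  refine hasGrowth_of_left_eigenvector (activityFunctional_intensityEnd hbal)
    activityFunctional_ne_zero hroots hev.first_eq hτ (fun i hi => ?_) hv
  have hi' : (⟨1, hq⟩ : Fin q) ≤ i := hi
  rcases (hev.re_antitone _ _ hi').lt_or_eq with h | h
  · exact Or.inl h
  · exact Or.inr ⟨h, fun v hv => intensityEnd_sub_pow_nu_apply hv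
      (hev.nu_antitone _ _ le_rfl hi' h.symm)⟩

end PolyaUrn

/-- Variation of constants for the Euler scheme. -/
theorem eq_sum_eulerProp {E : Type*} [NormedAddCommGroup E] [NormedSpace ℂ E] {f : Module.End ℂ E}
    {t : ℕ → ℝ} {z r : ℕ → E} {n : ℕ} (h0 : z 0 = 0)
    (h : ∀ k < n, z (k + 1) = z k + (t k : ℂ) • f (z k) + r k) :
    z n = ∑ k ∈ Finset.range n, eulerProp f t (k + 1) (n - (k + 1)) (r k) := by
  induction n with
  | zero => simpa using h0
  | succ n ih =>
    have ih' := ih fun k hk => h k (hk.trans (Nat.lt_succ_self n))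
    have hs : (∑ k ∈ Finset.range n, eulerProp f t (k + 1) (n + 1 - (k + 1)) (r k))
        = z n + (t n : ℂ) • f (z n) := by
      rw [ih', map_sum, Finset.smul_sum, ← Finset.sum_add_distrib]
      refine Finset.sum_congr rfl fun k hk => ?_
      have hk' := Finset.mem_range.1 hk
      have e : n + 1 - (k + 1) = (n - (k + 1)) + 1 := by omega
      have e2 : k + 1 + (n - (k + 1)) = n := by omega
      rw [e, eulerProp, e2]
      simp
    rw [Finset.sum_range_succ, hs, h n (Nat.lt_succ_self n)]
    simp [eulerProp]

namespace PolyaUrn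

variable {q : ℕ} (U : PolyaUrn q)

/-! ### The deterministic comparison process -/

/-- The value `σ_k = S_0 + b k` around which the total activity fluctuates. -/
noncomputable def driftActivity (b : ℝ) (k : ℕ) : ℝ := U.totalActivity U.init + b * k

/-- The step `1 / σ_k` of the Euler scheme. -/
noncomputable def timeStep (b : ℝ) (k : ℕ) : ℝ := 1 / U.driftActivity b k

/-- The deterministic process obtained from the urn by replacing each random increment by
`A c_k / σ_k`. -/
noncomputable def comparison (b : ℝ) : ℕ → Fin q → ℝ
  | 0 => fun i => U.init i
  | k + 1 => comparison b k + U.timeStep b k • U.intensityMatrix.mulVec (comparison b k)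

/-- The conditional expectation `V` of the replacement vector, given the composition `x`. -/
noncomputable def drift (x : EuclideanSpace ℝ (Fin q)) (l : Fin q) : ℝ :=
  ∑ j, U.drawProb x j * U.meanReplacement j l

/-- A vector of unit total activity, used to split off the direction in which the total activity is
measured. -/
noncomputable def unitVec : Fin q → ℝ :=
  Pi.single U.exists_activity_pos.choose (1 / U.activity U.exists_activity_pos.choose)

/-- The projection of the `i`-th standard basis vector to the vectors of total activity zero, along
`unitVec`. -/
noncomputable def projVec (i : Fin q) : Fin q → ℝ := Pi.single i 1 - U.activity i • U.unitVec

/-- The `l`-th coordinate at time `k + m` of the effect of a perturbation `projVec i` at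
time `k`. -/
noncomputable def kernelCoeff (b : ℝ) (k m : ℕ) (i l : Fin q) : ℝ :=
  (eulerProp U.intensityEnd (U.timeStep b) k m (fun j => (U.projVec i j : ℂ)) l).re

variable {U}

theorem sum_activity_mul_unitVec : ∑ i, U.activity i * U.unitVec i = 1 := by
  have := U.exists_activity_pos.choose_spec
  simp [unitVec, Pi.single_apply, this.ne']

theorem totalActivity_init_pos : 0 < U.totalActivity U.init := U.init_activity_pos

theorem driftActivity_pos {b : ℝ} (hb : 0 < b) (k : ℕ) : 0 < U.driftActivity b k := by
  have := U.totalActivity_init_pos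
  unfold driftActivity
  positivity

theorem timeStep_pos {b : ℝ} (hb : 0 < b) (k : ℕ) : 0 < U.timeStep b k :=
  one_div_pos.2 (driftActivity_pos hb k)

theorem sum_activity_mul_mulVec {b : ℝ} (hbal : U.BalancedInExpectation b) (y : Fin q → ℝ) :
    ∑ i, U.activity i * U.intensityMatrix.mulVec y i = b * ∑ i, U.activity i * y i := by
  simp only [Matrix.mulVec, dotProduct, Finset.mul_sum]
  rw [Finset.sum_comm]
  refine Finset.sum_congr rfl fun j _ => ?_
  rw [← mul_assoc, ← sum_activity_mul_mean hbal j, Finset.sum_mul]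
  refine Finset.sum_congr rfl fun i _ => ?_
  simp [intensityMatrix, meanReplacement]
  ring

theorem mulVec_eq_totalActivity_mul_drift (x : EuclideanSpace ℝ (Fin q))
    (hx : U.totalActivity x ≠ 0) (l : Fin q) :
    U.intensityMatrix.mulVec (fun i => x i) l = U.totalActivity x * U.drift x l := by
  simp only [drift, Matrix.mulVec, dotProduct, Finset.mul_sum]
  refine Finset.sum_congr rfl fun j _ => ?_
  simp only [intensityMatrix, Matrix.of_apply, drawProb, meanReplacement]
  field_simp

theorem sum_activity_mul_drift {b : ℝ} (hbal : U.BalancedInExpectation b)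
    (x : EuclideanSpace ℝ (Fin q)) (hx : U.totalActivity x ≠ 0) :
    ∑ i, U.activity i * U.drift x i = b := by
  have h1 := sum_activity_mul_mulVec hbal (fun i => x i)
  simp only [mulVec_eq_totalActivity_mul_drift x hx] at h1
  change _ = b * U.totalActivity x at h1
  have h2 : U.totalActivity x * ∑ i, U.activity i * U.drift x i = U.totalActivity x * b := by
    rw [mul_comm _ b, ← h1, Finset.mul_sum]
    exact Finset.sum_congr rfl fun i _ => by ring
  exact mul_left_cancel₀ hx h2

theorem intensityEnd_ofReal (y : Fin q → ℝ) :
    U.intensityEnd (fun j => (y j : ℂ)) = fun j => ((U.intensityMatrix.mulVec y j : ℝ) : ℂ) := by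
  ext l
  simp [intensityEnd, intensityMatrixC, Matrix.mulVec, dotProduct]

theorem activityFunctional_projVec (i : Fin q) :
    U.activityFunctional (fun j => (U.projVec i j : ℂ)) = 0 := by
  have h : ∑ j, U.activity j * U.projVec i j = 0 := by
    have := U.sum_activity_mul_unitVec
    simp only [projVec, Pi.sub_apply, Pi.smul_apply, smul_eq_mul, mul_sub, Finset.sum_sub_distrib,
      mul_left_comm _ (U.activity i), ← Finset.mul_sum, this]
    simp [Pi.single_apply]
  change ∑ j, (U.activity j : ℂ) * (U.projVec i j : ℂ) = 0
  exact_mod_cast congrArg (fun r : ℝ => (r : ℂ)) h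

/-! ### Decomposition of the deviation along a path -/

section Path

variable {b : ℝ} (x : ℕ → EuclideanSpace ℝ (Fin q))

variable (U) in
/-- The increment of the path `x` at step `k`, minus its drift. -/
noncomputable def noise (k : ℕ) (i : Fin q) : ℝ := x (k + 1) i - x k i - U.drift (x k) i

variable (U b) in
/-- The deviation `S_k - σ_k` of the total activity. -/
noncomputable def activityDev (k : ℕ) : ℝ := U.totalActivity (x k) - U.driftActivity b k

variable (U b) in
/-- The perturbation of the linear recursion at step `k`: the noise, and the error of replacing
`A x_k / S_k` by `A x_k / σ_k`. -/
noncomputable def perturbation (k : ℕ) (i : Fin q) : ℝ :=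
  U.noise x k i + U.timeStep b k * activityDev U b x k *
    (U.intensityMatrix.mulVec U.unitVec i - U.drift (x k) i)

variable {x}

theorem activityDev_succ (hbal : U.BalancedInExpectation b) {k : ℕ}
    (hx : 0 < U.totalActivity (x k)) :
    activityDev U b x (k + 1) = activityDev U b x k + ∑ i, U.activity i * U.noise x k i := by
  have h := sum_activity_mul_drift hbal (x k) hx.ne'
  simp only [noise, mul_sub, Finset.sum_sub_distrib, h]
  simp only [activityDev, driftActivity, totalActivity]
  push_cast
  ring

theorem activityDev_eq_sum (hbal : U.BalancedInExpectation b) (h0 : x 0 = U.init) {n : ℕ}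
    (hx : ∀ k < n, 0 < U.totalActivity (x k)) :
    activityDev U b x n = ∑ k ∈ Finset.range n, ∑ i, U.activity i * U.noise x k i := by
  induction n with
  | zero => simp [activityDev, driftActivity, h0]
  | succ n ih =>
    rw [activityDev_succ hbal (hx n (Nat.lt_succ_self n)), Finset.sum_range_succ,
      ih fun k hk => hx k (hk.trans (Nat.lt_succ_self n))]

/-- The deviation from the comparison process, projected to total activity zero, satisfies the linear
recursion of the Euler scheme, perturbed by vectors of total activity zero. -/
theorem projected_step (hbal : U.BalancedInExpectation b) {k : ℕ}
    (hx : 0 < U.totalActivity (x k)) (l : Fin q) :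
    x (k + 1) l - U.comparison b (k + 1) l - activityDev U b x (k + 1) * U.unitVec l =
      (x k l - U.comparison b k l - activityDev U b x k * U.unitVec l)
      + U.timeStep b k * U.intensityMatrix.mulVec
        (fun l => x k l - U.comparison b k l - activityDev U b x k * U.unitVec l) l
      + ∑ i, perturbation U b x k i * U.projVec i l := by
  have hσ := driftActivity_pos (U := U) hbal.1 k
  have e1 : U.intensityMatrix.mulVec
        (fun l => x k l - U.comparison b k l - activityDev U b x k * U.unitVec l) l
      = U.totalActivity (x k) * U.drift (x k) l - U.intensityMatrix.mulVec (U.comparison b k) l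
        - activityDev U b x k * U.intensityMatrix.mulVec U.unitVec l := by
    rw [← mulVec_eq_totalActivity_mul_drift (x k) hx.ne' l]
    simp only [Matrix.mulVec, dotProduct, mul_sub, Finset.sum_sub_distrib, Finset.mul_sum]
    congr 1
    exact Finset.sum_congr rfl fun i _ => by ring
  have e2 : ∑ i, U.activity i * perturbation U b x k i = ∑ i, U.activity i * U.noise x k i := by
    have h1 := sum_activity_mul_drift hbal (x k) hx.ne'
    have h2 := sum_activity_mul_mulVec hbal U.unitVec
    rw [sum_activity_mul_unitVec, mul_one] at h2
    simp only [perturbation, mul_add, Finset.sum_add_distrib, mul_sub, Finset.sum_sub_distrib,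
      mul_left_comm (U.activity _), ← Finset.mul_sum, h1, h2]
    ring
  have e3 : ∑ i, perturbation U b x k i * U.projVec i l
      = perturbation U b x k l - (∑ i, U.activity i * U.noise x k i) * U.unitVec l := by
    rw [← e2, Finset.sum_mul]
    simp only [projVec, Pi.sub_apply, Pi.smul_apply, smul_eq_mul, mul_sub, Finset.sum_sub_distrib]
    congr 1
    · simp [Pi.single_apply]
    · exact Finset.sum_congr rfl fun i _ => by ring
  -- `S_k - (S_k - σ_k) = σ_k`: the terms with the unbounded factor `S_k` cancel
  have e4 : U.timeStep b k * (U.totalActivity (x k) - activityDev U b x k) = 1 := by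
    simp only [activityDev, timeStep]
    field_simp
    ring
  rw [e3, e1, activityDev_succ hbal hx]
  simp only [perturbation, comparison, noise, Pi.add_apply, Pi.smul_apply, smul_eq_mul]
  linear_combination (-U.drift (x k) l) * e4

/-- The deviation of a path from the comparison process, as the accumulated effect of all
perturbations plus the deviation of the total activity. -/
theorem sub_comparison_eq (hbal : U.BalancedInExpectation b) (h0 : x 0 = U.init) {n : ℕ}
    (hx : ∀ k < n, 0 < U.totalActivity (x k)) (l : Fin q) :
    x n l - U.comparison b n l =
      (∑ k ∈ Finset.range n, ∑ i, perturbation U b x k i *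
        U.kernelCoeff b (k + 1) (n - (k + 1)) i l) + activityDev U b x n * U.unitVec l := by
  set z : ℕ → Fin q → ℂ := fun k l =>
    ((x k l - U.comparison b k l - activityDev U b x k * U.unitVec l : ℝ) : ℂ) with hz
  set r : ℕ → Fin q → ℂ := fun k =>
    ∑ i, (perturbation U b x k i : ℂ) • (fun j => (U.projVec i j : ℂ)) with hr
  have hz0 : z 0 = 0 := by
    ext l
    simp [hz, h0, comparison, activityDev, driftActivity]
  have hstep : ∀ k < n, z (k + 1) = z k + (U.timeStep b k : ℂ) • U.intensityEnd (z k) + r k := by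
    intro k hk
    ext l
    simp only [hz, hr]
    rw [intensityEnd_ofReal, projected_step hbal (hx k hk) l]
    simp
  have h := congrArg (fun v => (v l).re) (eq_sum_eulerProp hz0 hstep)
  simp only [hz, hr, Complex.ofReal_re, map_sum, map_smul, Finset.sum_apply, Complex.re_sum,
    Pi.smul_apply, smul_eq_mul, Complex.re_ofReal_mul] at h
  rw [← sub_eq_iff_eq_add, h]
  rfl

end Path

/-! ### Size of the kernel -/

theorem timeStep_le {b : ℝ} (hb : 0 < b) (k : ℕ) :
    U.timeStep b k ≤ 1 / U.totalActivity U.init := by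
  have := U.totalActivity_init_pos
  refine one_div_le_one_div_of_le this ?_
  unfold driftActivity
  have : 0 ≤ b * k := by positivity
  linarith

theorem exists_timeStep_le_div {b : ℝ} (hb : 0 < b) :
    ∃ C : ℝ, 0 < C ∧ ∀ k : ℕ, U.timeStep b k ≤ C / (k + 1) := by
  have h0 := U.totalActivity_init_pos
  refine ⟨1 / min (U.totalActivity U.init) b, by positivity, fun k => ?_⟩
  rw [timeStep, div_div]
  refine one_div_le_one_div_of_le (by positivity) ?_
  unfold driftActivity
  have h1 := min_le_left (U.totalActivity U.init) b
  have h2 := mul_le_mul_of_nonneg_right (min_le_right (U.totalActivity U.init) b)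
    (Nat.cast_nonneg (α := ℝ) k)
  linarith

theorem exists_sum_timeStep_sq_le {b : ℝ} (hb : 0 < b) :
    ∃ Q : ℝ, ∀ k m : ℕ, ∑ i ∈ Finset.range m, U.timeStep b (k + i) ^ 2 ≤ Q := by
  obtain ⟨C, hC, h⟩ := U.exists_timeStep_le_div hb
  obtain ⟨D, hD, h'⟩ := sum_rpow_neg_le_of_one_lt (s := 2) one_lt_two
  refine ⟨C ^ 2 * D, fun k m => ?_⟩
  calc ∑ i ∈ Finset.range m, U.timeStep b (k + i) ^ 2
      ≤ ∑ i ∈ Finset.range m, C ^ 2 * ((i : ℝ) + 1) ^ (-2 : ℝ) := by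
        refine Finset.sum_le_sum fun i _ => ?_
        have h1 : U.timeStep b (k + i) ≤ C / (i + 1) := by
          refine (h (k + i)).trans ?_
          push_cast
          have : (0 : ℝ) ≤ k := Nat.cast_nonneg k
          gcongr
          linarith
        have h2 := pow_le_pow_left₀ (timeStep_pos hb _).le h1 2
        refine h2.trans (le_of_eq ?_)
        rw [Real.rpow_neg (by positivity), Real.rpow_two, div_pow, div_eq_mul_inv]
    _ ≤ C ^ 2 * D := by rw [← Finset.mul_sum]; gcongr; exact h' m

theorem sum_timeStep_le {b : ℝ} (hb : 0 < b) {n k : ℕ} (hk : k < n) :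
    ∑ i ∈ Finset.range (n - (k + 1)), U.timeStep b (k + 1 + i)
      ≤ 1 / b * (1 + Real.log ((n : ℝ) / (k + 1))) := by
  have h := sum_one_div_le_log (k := k + 1) (by omega) (n - (k + 1))
  have e : ((k + 1 : ℕ) : ℝ) + ((n - (k + 1) : ℕ) : ℝ) = n := by
    rw [← Nat.cast_add]; congr 1; omega
  rw [e] at h
  push_cast at h
  calc _ ≤ ∑ i ∈ Finset.range (n - (k + 1)), 1 / b * (1 / ((k : ℝ) + 1 + i)) := by
        refine Finset.sum_le_sum fun i _ => ?_
        rw [timeStep, one_div_mul_one_div]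
        have h0 := U.totalActivity_init_pos
        refine one_div_le_one_div_of_le (by positivity) ?_
        unfold driftActivity
        push_cast
        linarith
    _ ≤ _ := by rw [← Finset.mul_sum]; gcongr

theorem abs_kernelCoeff_le {b : ℝ} (hb : 0 < b) {β : ℝ} (hβ : 0 < β) {ν : ℕ}
    (hgrow : ∀ (Q : ℝ) (v : Fin q → ℂ), U.activityFunctional v = 0 →
      HasGrowth U.intensityEnd (1 / U.totalActivity U.init) Q β ν v) :
    ∃ C : ℝ, 0 < C ∧ ∀ (n k : ℕ), k < n → ∀ i l : Fin q,
      |U.kernelCoeff b (k + 1) (n - (k + 1)) i l| ≤ C * stepWeight (β / b) ν n k := by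
  obtain ⟨Q, hQ⟩ := U.exists_sum_timeStep_sq_le hb
  choose C hC0 hC using fun i => hgrow Q _ (activityFunctional_projVec (U := U) i)
  set D : ℝ := (1 + ∑ i, C i) * Real.exp (β / b) * (1 + 1 / b) ^ ν with hD
  have hsum : 0 ≤ ∑ i, C i := Finset.sum_nonneg fun i _ => hC0 i
  refine ⟨D, by positivity, fun n k hk i l => ?_⟩
  have h1 := hC i (U.timeStep b) (k + 1) (n - (k + 1)) (fun j => (timeStep_pos hb j).le)
    (fun j => timeStep_le hb j) (hQ _ _)
  have hT0 : 0 ≤ ∑ i ∈ Finset.range (n - (k + 1)), U.timeStep b (k + 1 + i) :=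
    Finset.sum_nonneg fun j _ => (timeStep_pos hb _).le
  have hT := U.sum_timeStep_le hb hk
  set T := ∑ i ∈ Finset.range (n - (k + 1)), U.timeStep b (k + 1 + i)
  have hn0 : (0 : ℝ) < n := by exact_mod_cast (by omega : 0 < n)
  have hfrac : (0 : ℝ) < (n : ℝ) / (k + 1) := by positivity
  have hlogn : 0 ≤ Real.log n := Real.log_natCast_nonneg n
  have hlog : Real.log ((n : ℝ) / (k + 1)) ≤ Real.log n := by
    refine Real.log_le_log hfrac (div_le_self hn0.le ?_)
    linarith [(Nat.cast_nonneg k : (0 : ℝ) ≤ k)]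
  have h2 : Real.exp (β * T) ≤ Real.exp (β / b) * ((n : ℝ) / (k + 1)) ^ (β / b) := by
    rw [Real.rpow_def_of_pos hfrac, ← Real.exp_add]
    refine Real.exp_le_exp.2 ((mul_le_mul_of_nonneg_left hT hβ.le).trans (le_of_eq ?_))
    ring
  have h3 : (1 + T) ^ ν ≤ (1 + 1 / b) ^ ν * (1 + Real.log n) ^ ν := by
    rw [← mul_pow]
    have hb' : 0 < 1 / b := by positivity
    have : 1 / b * (1 + Real.log ((n : ℝ) / (k + 1))) ≤ 1 / b * (1 + Real.log n) := by gcongr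
    have : 1 + T ≤ (1 + 1 / b) * (1 + Real.log n) := by linarith
    gcongr
  have hCi : C i ≤ 1 + ∑ i, C i := by
    have := Finset.single_le_sum (f := C) (fun i _ => hC0 i) (Finset.mem_univ i)
    linarith
  calc |U.kernelCoeff b (k + 1) (n - (k + 1)) i l|
      ≤ ‖eulerProp U.intensityEnd (U.timeStep b) (k + 1) (n - (k + 1))
          (fun j => (U.projVec i j : ℂ))‖ :=
        (Complex.abs_re_le_norm _).trans (norm_le_pi_norm _ l)
    _ ≤ C i * Real.exp (β * T) * (1 + T) ^ ν := h1
    _ ≤ (1 + ∑ i, C i) * (Real.exp (β / b) * ((n : ℝ) / (k + 1)) ^ (β / b)) *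
          ((1 + 1 / b) ^ ν * (1 + Real.log n) ^ ν) := by gcongr
    _ = D * stepWeight (β / b) ν n k := by rw [hD, stepWeight]; ring

end PolyaUrn

namespace PolyaUrn

variable {q : ℕ} {U : PolyaUrn q}

/-! ### The law of one step -/

/-- The `σ`-algebra generated by `X_0, …, X_n`. -/
@[reducible] def past {Ω : Type*} (X : ℕ → Ω → EuclideanSpace ℝ (Fin q)) (n : ℕ) :
    MeasurableSpace Ω :=
  ⨆ k ≤ n, MeasurableSpace.comap (X k) inferInstance

theorem past_mono {Ω : Type*} {X : ℕ → Ω → EuclideanSpace ℝ (Fin q)} : Monotone (past X) :=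
  fun _ _ hmn => iSup₂_le fun k hk => le_iSup₂_of_le k (hk.trans hmn) le_rfl

theorem measurable_past {Ω : Type*} {X : ℕ → Ω → EuclideanSpace ℝ (Fin q)} {k n : ℕ} (hk : k ≤ n) :
    Measurable[past X n] (X k) :=
  Measurable.of_comap_le (le_iSup₂_of_le (f := fun k (_ : k ≤ n) =>
    MeasurableSpace.comap (X k) inferInstance) k hk le_rfl)

theorem measurable_totalActivity : Measurable U.totalActivity := by
  unfold totalActivity; fun_prop

theorem measurable_drawProb (i : Fin q) : Measurable fun x => U.drawProb x i := by
  have := U.measurable_totalActivity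
  unfold drawProb; fun_prop

theorem measurable_drift (l : Fin q) : Measurable fun x => U.drift x l := by
  have := U.measurable_drawProb
  unfold drift; fun_prop

theorem measurableSet_nonExtinct {Ω : Type*} {X : ℕ → Ω → EuclideanSpace ℝ (Fin q)} (n : ℕ) :
    MeasurableSet[past X n] (U.nonExtinct X n) := by
  have : U.nonExtinct X n = ⋂ k, ⋂ (_ : k ≤ n), {ω | 0 < U.totalActivity (X k ω)} := by
    ext ω; simp [nonExtinct]
  rw [this]
  refine MeasurableSet.iInter fun k => MeasurableSet.iInter fun hk => ?_
  exact (measurable_totalActivity.comp (measurable_past hk)) measurableSet_Ioi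

/-- The noise at step `n`, on survival up to time `n`: a martingale difference. -/
noncomputable def mgDiff (U : PolyaUrn q) {Ω : Type*} (X : ℕ → Ω → EuclideanSpace ℝ (Fin q))
    (i : Fin q) (n : ℕ) : Ω → ℝ :=
  (U.nonExtinct X n).indicator fun ω => U.noise (fun k => X k ω) n i

theorem measurable_noise {Ω : Type*} {X : ℕ → Ω → EuclideanSpace ℝ (Fin q)} (n : ℕ) (i : Fin q) :
    Measurable[past X (n + 1)] fun ω => U.noise (fun k => X k ω) n i := by
  have h1 : Measurable[past X (n + 1)] (X (n + 1)) := measurable_past le_rfl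
  have h2 : Measurable[past X (n + 1)] (X n) := measurable_past (Nat.le_succ n)
  have h3 : Measurable fun x : EuclideanSpace ℝ (Fin q) => x i := by fun_prop
  exact ((h3.comp h1).sub (h3.comp h2)).sub ((measurable_drift i).comp h2)

theorem measurable_mgDiff {Ω : Type*} {X : ℕ → Ω → EuclideanSpace ℝ (Fin q)} (n : ℕ) (i : Fin q) :
    Measurable[past X (n + 1)] (U.mgDiff X i n) :=
  (measurable_noise n i).indicator (past_mono (Nat.le_succ n) _ (measurableSet_nonExtinct n))

section Step

variable {Ω : Type*} [MeasurableSpace Ω] {P : Measure Ω} {X : ℕ → Ω → EuclideanSpace ℝ (Fin q)}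

theorem IsUrnChain.past_le (hX : U.IsUrnChain P X) (n : ℕ) : past X n ≤ ‹MeasurableSpace Ω› :=
  iSup₂_le fun k _ => (hX.measurable k).comap_le

theorem drawProb_nonneg {x : EuclideanSpace ℝ (Fin q)} (hx : ∀ i, 0 ≤ x i) (i : Fin q) :
    0 ≤ U.drawProb x i :=
  div_nonneg (mul_nonneg (U.activity_nonneg i) (hx i))
    (Finset.sum_nonneg fun j _ => mul_nonneg (U.activity_nonneg j) (hx j))

theorem drawProb_le_one {x : EuclideanSpace ℝ (Fin q)} (hx : ∀ i, 0 ≤ x i) (i : Fin q) :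
    U.drawProb x i ≤ 1 :=
  div_le_one_of_le₀ (Finset.single_le_sum (f := fun j => U.activity j * x j)
    (fun j _ => mul_nonneg (U.activity_nonneg j) (hx j)) (Finset.mem_univ i))
    (Finset.sum_nonneg fun j _ => mul_nonneg (U.activity_nonneg j) (hx j))

variable [IsProbabilityMeasure P]

theorem integrable_drawProb (hX : U.IsUrnChain P X) (hT : Tenable P X) (n : ℕ) (i : Fin q) :
    Integrable (fun ω => U.drawProb (X n ω) i) P := by
  refine Integrable.of_bound (((measurable_drawProb i).comp (hX.measurable n)).aestronglyMeasurable)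
    1 ?_
  filter_upwards [hT n] with ω hω
  rw [Real.norm_eq_abs, abs_of_nonneg (drawProb_nonneg hω i)]
  exact drawProb_le_one hω i

theorem setIntegral_stepProb (hX : U.IsUrnChain P X) {n : ℕ} {G : Set Ω}
    (hG : MeasurableSet[past X n] G) {B : Set (EuclideanSpace ℝ (Fin q))} (hB : MeasurableSet B) :
    ∫ ω in G, U.stepProb (X n ω) B ∂P = P.real ({ω | X (n + 1) ω - X n ω ∈ B} ∩ G) := by
  have hm : Measurable fun ω => X (n + 1) ω - X n ω :=
    (hX.measurable _).sub (hX.measurable _)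
  have hs : MeasurableSet {ω | X (n + 1) ω - X n ω ∈ B} := hm hB
  have hint : Integrable (({ω | X (n + 1) ω - X n ω ∈ B}).indicator fun _ => (1 : ℝ)) P :=
    (integrable_const 1).indicator hs
  have h1 := setIntegral_condExp (hX.past_le n) hint hG
  have h2 := setIntegral_congr_ae (hX.past_le n _ hG)
    ((hX.step n B hB).mono fun ω h (_ : ω ∈ G) => h)
  rw [← h2]
  refine h1.trans ?_
  rw [integral_indicator hs]
  simp [Measure.restrict_restrict hs]

/-- On an event of the past on which a ball is drawn, the replacement vector has the law of the
`ξ_i`, mixed with the average drawing probabilities. -/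
theorem map_restrict_sub_eq (hX : U.IsUrnChain P X) (hT : Tenable P X) {n : ℕ} {G : Set Ω}
    (hG : MeasurableSet[past X n] G) (hpos : ∀ ω ∈ G, 0 < U.totalActivity (X n ω)) :
    (P.restrict G).map (fun ω => X (n + 1) ω - X n ω) =
      ∑ i, ENNReal.ofReal (∫ ω in G, U.drawProb (X n ω) i ∂P) • U.replacement i := by
  have hG' := hX.past_le n _ hG
  have hm : Measurable fun ω => X (n + 1) ω - X n ω :=
    (hX.measurable _).sub (hX.measurable _)
  have hc : ∀ i, 0 ≤ ∫ ω in G, U.drawProb (X n ω) i ∂P := fun i =>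
    integral_nonneg_of_ae ((ae_restrict_of_ae (hT n)).mono fun ω h => drawProb_nonneg h i)
  have := U.isProbabilityMeasure_replacement
  ext B hB
  rw [Measure.map_apply hm hB, Measure.restrict_apply (hm hB), Measure.finsetSum_apply]
  simp only [Measure.smul_apply, smul_eq_mul]
  have h1 := setIntegral_stepProb hX hG hB
  have h2 : ∫ ω in G, U.stepProb (X n ω) B ∂P
      = ∑ i, (∫ ω in G, U.drawProb (X n ω) i ∂P) * (U.replacement i).real B := by
    rw [setIntegral_congr_fun (g := fun ω => ∑ i, U.drawProb (X n ω) i * (U.replacement i).real B)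
      hG' (fun ω hω => by simp [stepProb, hpos ω hω]), integral_finsetSum]
    · simp only [integral_mul_const]
    · exact fun i _ => ((integrable_drawProb hX hT n i).integrableOn).mul_const _
  rw [h2] at h1
  have h3 := congrArg ENNReal.ofReal h1
  rw [ofReal_measureReal, ENNReal.ofReal_sum_of_nonneg
    (fun i _ => mul_nonneg (hc i) measureReal_nonneg)] at h3
  refine h3.symm.trans (Finset.sum_congr rfl fun i _ => ?_)
  rw [ENNReal.ofReal_mul (hc i), ofReal_measureReal]

/-- Where no ball is drawn, the composition does not change. -/
theorem ae_sub_eq_zero (hX : U.IsUrnChain P X) (n : ℕ) :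
    ∀ᵐ ω ∂P, ¬ 0 < U.totalActivity (X n ω) → X (n + 1) ω - X n ω = 0 := by
  set G : Set Ω := {ω | ¬ 0 < U.totalActivity (X n ω)} with hGdef
  have hG : MeasurableSet[past X n] G :=
    ((measurable_totalActivity.comp (measurable_past le_rfl)) measurableSet_Ioi).compl
  have hG' := hX.past_le n _ hG
  have hm : Measurable fun ω => X (n + 1) ω - X n ω :=
    (hX.measurable _).sub (hX.measurable _)
  have h1 := setIntegral_stepProb hX hG (B := {0}ᶜ) (measurableSet_singleton _).compl
  rw [setIntegral_congr_fun (g := fun _ => (0 : ℝ)) hG'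
    (fun ω hω => by simp [stepProb, show ¬ 0 < U.totalActivity (X n ω) from hω])] at h1
  rw [integral_zero] at h1
  have h2 : P ({ω | X (n + 1) ω - X n ω ∈ ({0}ᶜ : Set _)} ∩ G) = 0 :=
    (measureReal_eq_zero_iff).1 h1.symm
  have h3 : ∀ᵐ ω ∂P, ω ∉ {ω | X (n + 1) ω - X n ω ∈ ({0}ᶜ : Set _)} ∩ G :=
    measure_eq_zero_iff_ae_notMem.1 h2
  filter_upwards [h3] with ω hω h
  by_contra hne
  exact hω ⟨hne, h⟩

variable (U) in
/-- The sum of the laws of `ξ_1, …, ξ_q`, which dominates the law of every replacement vector. -/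
noncomputable def sumLaw : Measure (EuclideanSpace ℝ (Fin q)) := ∑ i, U.replacement i

theorem map_restrict_sub_le (hX : U.IsUrnChain P X) (hT : Tenable P X) {n : ℕ} {G : Set Ω}
    (hG : MeasurableSet[past X n] G) (hpos : ∀ ω ∈ G, 0 < U.totalActivity (X n ω)) :
    (P.restrict G).map (fun ω => X (n + 1) ω - X n ω) ≤ U.sumLaw := by
  rw [map_restrict_sub_eq hX hT hG hpos, sumLaw]
  refine Finset.sum_le_sum fun i _ => ?_
  have h : ENNReal.ofReal (∫ ω in G, U.drawProb (X n ω) i ∂P) ≤ 1 := by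
    rw [ENNReal.ofReal_le_one]
    have h1 : ∫ ω in G, U.drawProb (X n ω) i ∂P ≤ ∫ ω, U.drawProb (X n ω) i ∂P :=
      setIntegral_le_integral (integrable_drawProb hX hT n i)
        ((hT n).mono fun ω h => drawProb_nonneg h i)
    have h2 : ∫ ω, U.drawProb (X n ω) i ∂P ≤ ∫ _, (1 : ℝ) ∂P :=
      integral_mono_ae (integrable_drawProb hX hT n i) (integrable_const 1)
        ((hT n).mono fun ω h => drawProb_le_one h i)
    simpa using h1.trans h2
  intro B
  rw [Measure.smul_apply, smul_eq_mul]
  exact mul_le_of_le_one_left zero_le h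

theorem integrable_coord (hmom : ∀ i, Integrable (fun x : EuclideanSpace ℝ (Fin q) => x)
    (U.replacement i)) (i l : Fin q) : Integrable (fun x => x l) (U.replacement i) := by
  refine (hmom i).norm.mono' (by fun_prop) (ae_of_all _ fun x => ?_)
  exact PiLp.norm_apply_le x l

theorem integrableOn_sub (hX : U.IsUrnChain P X) (hT : Tenable P X)
    (hmom : ∀ i, Integrable (fun x : EuclideanSpace ℝ (Fin q) => x) (U.replacement i))
    {n : ℕ} {G : Set Ω} (hG : MeasurableSet[past X n] G)
    (hpos : ∀ ω ∈ G, 0 < U.totalActivity (X n ω)) :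
    IntegrableOn (fun ω => X (n + 1) ω - X n ω) G P := by
  have hm : Measurable fun ω => X (n + 1) ω - X n ω :=
    (hX.measurable _).sub (hX.measurable _)
  have h : Integrable (fun x => x) U.sumLaw := by
    rw [sumLaw, integrable_finsetSum_measure]
    exact fun i _ => hmom i
  have h2 := h.mono_measure (map_restrict_sub_le hX hT hG hpos)
  exact h2.comp_measurable hm

theorem integrable_process (hX : U.IsUrnChain P X) (hT : Tenable P X)
    (hmom : ∀ i, Integrable (fun x : EuclideanSpace ℝ (Fin q) => x) (U.replacement i)) (n : ℕ) :
    Integrable (X n) P := by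
  induction n with
  | zero =>
    exact (integrable_const U.init).congr (hX.init_eq.mono fun ω h => h.symm)
  | succ n ih =>
    set G : Set Ω := {ω | 0 < U.totalActivity (X n ω)} with hGdef
    have hG : MeasurableSet[past X n] G :=
      (measurable_totalActivity.comp (measurable_past le_rfl)) measurableSet_Ioi
    have h1 := (integrableOn_sub hX hT hmom hG fun ω hω => hω).integrable_indicator
      (hX.past_le n _ hG)
    refine (ih.add h1).congr ?_
    filter_upwards [ae_sub_eq_zero hX n] with ω hω
    by_cases h : ω ∈ G
    · simp [h]
    · have := sub_eq_zero.1 (hω h)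
      simp [h, this]

theorem integrable_process_coord (hX : U.IsUrnChain P X) (hT : Tenable P X)
    (hmom : ∀ i, Integrable (fun x : EuclideanSpace ℝ (Fin q) => x) (U.replacement i)) (n : ℕ)
    (l : Fin q) : Integrable (fun ω => X n ω l) P :=
  (integrable_process hX hT hmom n).norm.mono'
    (by have := hX.measurable n; fun_prop) (ae_of_all _ fun ω => PiLp.norm_apply_le _ l)

theorem integrable_sub_coord (hX : U.IsUrnChain P X) (hT : Tenable P X)
    (hmom : ∀ i, Integrable (fun x : EuclideanSpace ℝ (Fin q) => x) (U.replacement i)) (n : ℕ)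
    (l : Fin q) : Integrable (fun ω => X (n + 1) ω l - X n ω l) P :=
  (integrable_process_coord hX hT hmom (n + 1) l).sub (integrable_process_coord hX hT hmom n l)

/-- The drift is the conditional expectation of the replacement vector. -/
theorem setIntegral_sub_coord (hX : U.IsUrnChain P X) (hT : Tenable P X)
    (hmom : ∀ i, Integrable (fun x : EuclideanSpace ℝ (Fin q) => x) (U.replacement i))
    {n : ℕ} {G : Set Ω} (hG : MeasurableSet[past X n] G)
    (hpos : ∀ ω ∈ G, 0 < U.totalActivity (X n ω)) (l : Fin q) :
    ∫ ω in G, (X (n + 1) ω l - X n ω l) ∂P = ∫ ω in G, U.drift (X n ω) l ∂P := by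
  have hm : Measurable fun ω => X (n + 1) ω - X n ω :=
    (hX.measurable _).sub (hX.measurable _)
  have hc : ∀ i, 0 ≤ ∫ ω in G, U.drawProb (X n ω) i ∂P := fun i =>
    integral_nonneg_of_ae ((ae_restrict_of_ae (hT n)).mono fun ω h => drawProb_nonneg h i)
  have h1 : ∫ ω in G, (X (n + 1) ω l - X n ω l) ∂P
      = ∫ x, x l ∂((P.restrict G).map (fun ω => X (n + 1) ω - X n ω)) := by
    rw [integral_map hm.aemeasurable (by fun_prop)]
    rfl
  rw [h1, map_restrict_sub_eq hX hT hG hpos, integral_finsetSum_measure]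
  · simp only [drift]
    rw [integral_finsetSum _ fun i _ => ((integrable_drawProb hX hT n i).integrableOn).mul_const _]
    refine Finset.sum_congr rfl fun i _ => ?_
    rw [integral_smul_measure, integral_mul_const, ENNReal.toReal_ofReal (hc i), meanReplacement,
      smul_eq_mul]
  · exact fun i _ => (integrable_coord hmom i l).smul_measure ENNReal.ofReal_ne_top

theorem abs_drift_le {x : EuclideanSpace ℝ (Fin q)} (hx : ∀ i, 0 ≤ x i) (l : Fin q) :
    |U.drift x l| ≤ ∑ j, |U.meanReplacement j l| := by
  refine (Finset.abs_sum_le_sum_abs _ _).trans (Finset.sum_le_sum fun j _ => ?_)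
  rw [abs_mul, abs_of_nonneg (drawProb_nonneg hx j)]
  exact mul_le_of_le_one_left (abs_nonneg _) (drawProb_le_one hx j)

theorem integrable_drift (hX : U.IsUrnChain P X) (hT : Tenable P X) (n : ℕ) (l : Fin q) :
    Integrable (fun ω => U.drift (X n ω) l) P := by
  refine Integrable.of_bound (((measurable_drift l).comp (hX.measurable n)).aestronglyMeasurable)
    (∑ j, |U.meanReplacement j l|) ?_
  filter_upwards [hT n] with ω hω
  exact abs_drift_le hω l

/-! ### Survival -/

/-- Survival has positive probability at every time: on survival up to time `n`, the expected total
activity grows by `b`, so it cannot vanish almost surely at time `n + 1`. -/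
theorem measure_nonExtinct_pos (hX : U.IsUrnChain P X) (hT : Tenable P X)
    (hmom : ∀ i, Integrable (fun x : EuclideanSpace ℝ (Fin q) => x) (U.replacement i)) {b : ℝ}
    (hbal : U.BalancedInExpectation b) (n : ℕ) : 0 < P (U.nonExtinct X n) := by
  induction n with
  | zero =>
    have : ∀ᵐ ω ∂P, ω ∈ U.nonExtinct X 0 := by
      filter_upwards [hX.init_eq] with ω hω k hk
      rw [Nat.le_zero.1 hk, hω]
      exact totalActivity_init_pos
    exact one_pos.trans_eq ((measure_congr (Filter.eventuallyEq_univ.2 this)).trans measure_univ).symm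
  | succ n ih =>
    set G := U.nonExtinct X n with hGdef
    have hG : MeasurableSet[past X n] G := measurableSet_nonExtinct n
    have hG' := hX.past_le n _ hG
    have hpos : ∀ ω ∈ G, 0 < U.totalActivity (X n ω) := fun ω hω => hω n le_rfl
    have hI : ∀ m, Integrable (fun ω => U.totalActivity (X m ω)) P := fun m =>
      integrable_finsetSum _ fun l _ => (integrable_process_coord hX hT hmom m l).const_mul _
    have h1 : ∫ ω in G, (U.totalActivity (X (n + 1) ω) - U.totalActivity (X n ω)) ∂P
        = ∫ ω in G, b ∂P := by
      have e1 : ∀ ω, U.totalActivity (X (n + 1) ω) - U.totalActivity (X n ω)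
          = ∑ l, U.activity l * (X (n + 1) ω l - X n ω l) := fun ω => by
        simp [totalActivity, mul_sub, Finset.sum_sub_distrib]
      simp only [e1]
      rw [integral_finsetSum _ fun l _ =>
        ((integrable_sub_coord hX hT hmom n l).const_mul _).integrableOn]
      simp only [integral_const_mul, setIntegral_sub_coord hX hT hmom hG hpos]
      rw [setIntegral_congr_fun (f := fun _ => b)
        (g := fun ω => ∑ l, U.activity l * U.drift (X n ω) l) hG'
        (fun ω hω => (sum_activity_mul_drift hbal _ (hpos ω hω).ne').symm),
        integral_finsetSum _ fun l _ => ((integrable_drift hX hT n l).const_mul _).integrableOn]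
      simp only [integral_const_mul]
    by_contra hcon
    have h0 : P (U.nonExtinct X (n + 1)) = 0 := by simpa using hcon
    have h2 : ∀ᵐ ω ∂(P.restrict G), U.totalActivity (X (n + 1) ω) ≤ 0 := by
      rw [ae_restrict_iff' hG']
      filter_upwards [measure_eq_zero_iff_ae_notMem.1 h0] with ω hω hωG
      by_contra hlt
      refine hω fun k hk => ?_
      rcases Nat.lt_or_ge n k with h | h
      · rw [show k = n + 1 by omega]; exact not_le.1 hlt
      · exact hωG k h
    have h3 : ∫ ω in G, U.totalActivity (X (n + 1) ω) ∂P ≤ 0 := integral_nonpos_of_ae h2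
    have h4 : 0 ≤ ∫ ω in G, U.totalActivity (X n ω) ∂P :=
      setIntegral_nonneg hG' fun ω hω => (hpos ω hω).le
    rw [integral_sub (hI _).integrableOn (hI _).integrableOn, setIntegral_const, smul_eq_mul] at h1
    have h5 : 0 < P.real G := ENNReal.toReal_pos ih.ne' (measure_ne_top _ _)
    have := mul_pos h5 hbal.1
    linarith

/-! ### The martingale differences -/

theorem integrableOn_noise (hX : U.IsUrnChain P X) (hT : Tenable P X)
    (hmom : ∀ i, Integrable (fun x : EuclideanSpace ℝ (Fin q) => x) (U.replacement i))
    (n : ℕ) (i : Fin q) (G : Set Ω) :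
    IntegrableOn (fun ω => U.noise (fun k => X k ω) n i) G P := by
  exact ((integrable_sub_coord hX hT hmom n i).sub (integrable_drift hX hT n i)).integrableOn

theorem integrable_mgDiff (hX : U.IsUrnChain P X) (hT : Tenable P X)
    (hmom : ∀ i, Integrable (fun x : EuclideanSpace ℝ (Fin q) => x) (U.replacement i))
    (n : ℕ) (i : Fin q) : Integrable (U.mgDiff X i n) P :=
  (integrableOn_noise hX hT hmom n i _).integrable_indicator
    (hX.past_le n _ (measurableSet_nonExtinct n))

theorem setIntegral_mgDiff (hX : U.IsUrnChain P X) (hT : Tenable P X)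
    (hmom : ∀ i, Integrable (fun x : EuclideanSpace ℝ (Fin q) => x) (U.replacement i))
    (n : ℕ) (i : Fin q) {H : Set Ω} (hH : MeasurableSet[past X n] H) :
    ∫ ω in H, U.mgDiff X i n ω ∂P = 0 := by
  have hG : MeasurableSet[past X n] (H ∩ U.nonExtinct X n) :=
    MeasurableSet.inter hH (measurableSet_nonExtinct n)
  rw [mgDiff, setIntegral_indicator (hX.past_le n _ (measurableSet_nonExtinct n))]
  simp only [noise]
  rw [integral_sub (integrable_sub_coord hX hT hmom n i).integrableOn
    (integrable_drift hX hT n i).integrableOn,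
    setIntegral_sub_coord hX hT hmom hG (fun ω hω => hω.2 n le_rfl), sub_self]

variable (U) in
/-- A bound for the `L^p` norm of every martingale difference. -/
noncomputable def noiseBound (p : ℝ) : ℝ :=
  1 + ∑ l, (eLpNorm (fun x : EuclideanSpace ℝ (Fin q) => x l) (ENNReal.ofReal p) U.sumLaw).toReal
    + ∑ l, ∑ j, |U.meanReplacement j l|

theorem noiseBound_pos (p : ℝ) : 0 < U.noiseBound p := by
  unfold noiseBound
  have h1 := Finset.sum_nonneg fun (l : Fin q) (_ : l ∈ Finset.univ) => ENNReal.toReal_nonneg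
    (a := eLpNorm (fun x : EuclideanSpace ℝ (Fin q) => x l) (ENNReal.ofReal p) U.sumLaw)
  have h2 := Finset.sum_nonneg fun (l : Fin q) (_ : l ∈ Finset.univ) =>
    Finset.sum_nonneg fun (j : Fin q) (_ : j ∈ Finset.univ) => abs_nonneg (U.meanReplacement j l)
  linarith

theorem memLp_coord_sumLaw {p : ℝ} (hp : 2 ≤ p)
    (hmom : ∀ i, MemLp (fun x : EuclideanSpace ℝ (Fin q) => x) (ENNReal.ofReal p)
      (U.replacement i)) (l : Fin q) :
    MemLp (fun x : EuclideanSpace ℝ (Fin q) => x l) (ENNReal.ofReal p) U.sumLaw := by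
  have hp0 : ENNReal.ofReal p ≠ 0 := by simp; linarith
  rw [← integrable_norm_rpow_iff (by fun_prop) hp0 ENNReal.ofReal_ne_top, sumLaw,
    integrable_finsetSum_measure]
  intro i _
  refine MemLp.integrable_norm_rpow ?_ hp0 ENNReal.ofReal_ne_top
  exact (hmom i).of_le (by fun_prop) (ae_of_all _ fun x => PiLp.norm_apply_le x l)

theorem eLpNorm_mgDiff_le (hX : U.IsUrnChain P X) (hT : Tenable P X) {p : ℝ} (hp : 2 ≤ p)
    (hmom : ∀ i, MemLp (fun x : EuclideanSpace ℝ (Fin q) => x) (ENNReal.ofReal p)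
      (U.replacement i)) (n : ℕ) (i : Fin q) :
    eLpNorm (U.mgDiff X i n) (ENNReal.ofReal p) P ≤ ENNReal.ofReal (U.noiseBound p) := by
  have hG : MeasurableSet[past X n] (U.nonExtinct X n) := measurableSet_nonExtinct n
  have hG' := hX.past_le n _ hG
  have hp1 : 1 ≤ ENNReal.ofReal p := ENNReal.one_le_ofReal.2 (by linarith)
  have hm : Measurable fun ω => X (n + 1) ω - X n ω :=
    (hX.measurable _).sub (hX.measurable _)
  have hcoord : Measurable fun x : EuclideanSpace ℝ (Fin q) => x i := by fun_prop
  rw [mgDiff, eLpNorm_indicator_eq_eLpNorm_restrict hG']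
  have h1 : eLpNorm (fun ω => X (n + 1) ω i - X n ω i) (ENNReal.ofReal p)
      (P.restrict (U.nonExtinct X n)) ≤ ENNReal.ofReal
        (eLpNorm (fun x : EuclideanSpace ℝ (Fin q) => x i) (ENNReal.ofReal p) U.sumLaw).toReal := by
    rw [ENNReal.ofReal_toReal (memLp_coord_sumLaw hp hmom i).eLpNorm_ne_top]
    have e := eLpNorm_map_measure (p := ENNReal.ofReal p) (μ := P.restrict (U.nonExtinct X n))
      (hcoord.aestronglyMeasurable) hm.aemeasurable
    refine (le_of_eq ?_).trans
      (eLpNorm_mono_measure _ (map_restrict_sub_le hX hT hG fun ω hω => hω n le_rfl))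
    rw [e]
    rfl
  have h2 : eLpNorm (fun ω => U.drift (X n ω) i) (ENNReal.ofReal p)
      (P.restrict (U.nonExtinct X n)) ≤ ENNReal.ofReal (∑ j, |U.meanReplacement j i|) := by
    refine (eLpNorm_mono_measure _ Measure.restrict_le_self).trans ?_
    have := eLpNorm_le_of_ae_bound (p := ENNReal.ofReal p) (f := fun ω => U.drift (X n ω) i)
      ((hT n).mono fun ω hω => (abs_drift_le (U := U) hω i))
    simpa using this
  have h3 := eLpNorm_sub_le (μ := P.restrict (U.nonExtinct X n)) (p := ENNReal.ofReal p)
    (f := fun ω => X (n + 1) ω i - X n ω i) (g := fun ω => U.drift (X n ω) i)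
    (hcoord.comp hm).aestronglyMeasurable
    ((measurable_drift i).comp (hX.measurable n)).aestronglyMeasurable hp1
  refine h3.trans ((add_le_add h1 h2).trans ?_)
  rw [← ENNReal.ofReal_add ENNReal.toReal_nonneg (Finset.sum_nonneg fun j _ => abs_nonneg _)]
  refine ENNReal.ofReal_le_ofReal ?_
  have e1 := Finset.single_le_sum (f := fun l => (eLpNorm (fun x : EuclideanSpace ℝ (Fin q) => x l)
    (ENNReal.ofReal p) U.sumLaw).toReal) (fun l _ => ENNReal.toReal_nonneg) (Finset.mem_univ i)
  have e2 := Finset.single_le_sum (f := fun l => ∑ j, |U.meanReplacement j l|)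
    (fun l _ => Finset.sum_nonneg fun j _ => abs_nonneg _) (Finset.mem_univ i)
  unfold noiseBound
  linarith

end Step

end PolyaUrn

/-! ### `L^p` bounds with real constants -/

section LpLe

variable {Ω : Type*} [MeasurableSpace Ω]

/-- `f` is measurable and its `L^p` norm is at most the real number `B ≥ 0`. -/
def LpLe (P : Measure Ω) (p : ℝ) (f : Ω → ℝ) (B : ℝ) : Prop :=
  Measurable f ∧ 0 ≤ B ∧ eLpNorm f (ENNReal.ofReal p) P ≤ ENNReal.ofReal B

variable {P : Measure Ω} {p : ℝ} {f g : Ω → ℝ} {A B : ℝ}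

theorem LpLe.mono (h : LpLe P p f A) (hAB : A ≤ B) : LpLe P p f B :=
  ⟨h.1, h.2.1.trans hAB, h.2.2.trans (ENNReal.ofReal_le_ofReal hAB)⟩

theorem LpLe.add (hp : 1 ≤ p) (hf : LpLe P p f A) (hg : LpLe P p g B) :
    LpLe P p (fun ω => f ω + g ω) (A + B) := by
  refine ⟨hf.1.add hg.1, add_nonneg hf.2.1 hg.2.1, ?_⟩
  rw [ENNReal.ofReal_add hf.2.1 hg.2.1]
  exact (eLpNorm_add_le hf.1.aestronglyMeasurable hg.1.aestronglyMeasurable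
    (ENNReal.one_le_ofReal.2 hp)).trans (add_le_add hf.2.2 hg.2.2)

theorem LpLe.sum (hp : 1 ≤ p) {ι : Type*} (s : Finset ι) {F : ι → Ω → ℝ} {D : ι → ℝ}
    (h : ∀ i ∈ s, LpLe P p (F i) (D i)) :
    LpLe P p (fun ω => ∑ i ∈ s, F i ω) (∑ i ∈ s, D i) := by
  classical
  induction s using Finset.induction_on with
  | empty => exact ⟨by simp, by simp, by simp⟩
  | insert a s ha ih =>
    simp only [Finset.sum_insert ha]
    exact (h a (Finset.mem_insert_self _ _)).add hp
      (ih fun i hi => h i (Finset.mem_insert_of_mem hi))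

theorem LpLe.of_ae_abs_le (hf : Measurable f) {c : ℝ} (hc : 0 ≤ c) (hg : LpLe P p g B)
    (h : ∀ᵐ ω ∂P, |f ω| ≤ c * |g ω|) : LpLe P p f (c * B) := by
  refine ⟨hf, mul_nonneg hc hg.2.1, ?_⟩
  rw [ENNReal.ofReal_mul hc]
  exact (eLpNorm_le_mul_eLpNorm_of_ae_le_mul h _).trans (by gcongr; exact hg.2.2)

theorem LpLe.mul_const (hf : LpLe P p f B) {c C : ℝ} (hc : |c| ≤ C) :
    LpLe P p (fun ω => f ω * c) (C * B) :=
  LpLe.of_ae_abs_le (hf.1.mul_const c) ((abs_nonneg c).trans hc) hf (ae_of_all _ fun ω => by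
    rw [abs_mul, mul_comm]; gcongr)

theorem LpLe.abs (hf : LpLe P p f B) : LpLe P p (fun ω => |f ω|) B := by
  simpa using LpLe.of_ae_abs_le (f := fun ω => |f ω|) (by have := hf.1; fun_prop) zero_le_one hf
    (ae_of_all _ fun ω => by simp)

theorem LpLe.integrable_rpow (hp : 2 ≤ p) (hf : LpLe P p f B) :
    Integrable (fun ω => |f ω| ^ p) P ∧ ∫ ω, |f ω| ^ p ∂P ≤ B ^ p := by
  have hp0 : 0 < p := by linarith
  have hp1 : ENNReal.ofReal p ≠ 0 := by simpa using hp0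
  have hmem : MemLp f (ENNReal.ofReal p) P :=
    ⟨hf.1.aestronglyMeasurable, hf.2.2.trans_lt ENNReal.ofReal_lt_top⟩
  have hI := hmem.integrable_norm_rpow hp1 ENNReal.ofReal_ne_top
  simp only [ENNReal.toReal_ofReal hp0.le, Real.norm_eq_abs] at hI
  refine ⟨hI, ?_⟩
  have h := hf.2.2
  rw [hmem.eLpNorm_eq_integral_rpow_norm hp1 ENNReal.ofReal_ne_top,
    ENNReal.ofReal_le_ofReal_iff hf.2.1] at h
  simp only [ENNReal.toReal_ofReal hp0.le, Real.norm_eq_abs] at h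
  have h0 : 0 ≤ ∫ ω, |f ω| ^ p ∂P := integral_nonneg fun ω => by positivity
  have h1 := Real.rpow_le_rpow (by positivity) h hp0.le
  rwa [← Real.rpow_mul h0, inv_mul_cancel₀ hp0.ne', Real.rpow_one] at h1

theorem LpLe.of_integral_rpow (hp : 2 ≤ p) (hf : Measurable f) (hB : 0 ≤ B)
    (hI : Integrable (fun ω => |f ω| ^ p) P) (h : ∫ ω, |f ω| ^ p ∂P ≤ B ^ p) : LpLe P p f B := by
  have hp0 : 0 < p := by linarith
  have hp1 : ENNReal.ofReal p ≠ 0 := by simpa using hp0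
  have hmem : MemLp f (ENNReal.ofReal p) P := by
    rw [← integrable_norm_rpow_iff hf.aestronglyMeasurable hp1 ENNReal.ofReal_ne_top]
    simpa only [ENNReal.toReal_ofReal hp0.le, Real.norm_eq_abs] using hI
  refine ⟨hf, hB, ?_⟩
  rw [hmem.eLpNorm_eq_integral_rpow_norm hp1 ENNReal.ofReal_ne_top]
  refine ENNReal.ofReal_le_ofReal ?_
  simp only [ENNReal.toReal_ofReal hp0.le, Real.norm_eq_abs]
  have h0 : 0 ≤ ∫ ω, |f ω| ^ p ∂P := integral_nonneg fun ω => by positivity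
  have h1 := Real.rpow_le_rpow h0 h (inv_nonneg.2 hp0.le)
  rwa [← Real.rpow_mul hB, mul_inv_cancel₀ hp0.ne', Real.rpow_one] at h1

end LpLe

theorem exists_lpLe_sum_martingale {p : ℝ} (hp : 2 ≤ p) :
    ∃ K : ℝ, 1 ≤ K ∧ ∀ {Ω : Type*} {m : MeasurableSpace Ω} (P : Measure Ω) [IsProbabilityMeasure P]
      (F : ℕ → MeasurableSpace Ω), Monotone F → (∀ k, F k ≤ m) →
      ∀ (d : ℕ → Ω → ℝ) (δ : ℕ → ℝ) (β : ℝ), 0 < β → (∀ k, 0 < δ k) →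
      (∀ k, Measurable[F (k + 1)] (d k)) →
      (∀ k, Integrable (d k) P) →
      (∀ k s, MeasurableSet[F k] s → ∫ ω in s, d k ω ∂P = 0) →
      (∀ k, LpLe P p (d k) (δ k)) → ∀ n : ℕ,
      LpLe P p (fun ω => ∑ k ∈ Finset.range n, d k ω)
        √(β + K * ∑ k ∈ Finset.range n, δ k ^ 2) := by
  obtain ⟨K, hK, h⟩ := exists_integral_abs_sum_rpow_le hp
  refine ⟨K, hK, ?_⟩
  intro Ω m P _ F hmono hF d δ β hβ hδ hmeas hint hmart hbd n
  have h1 := h P F hmono hF d δ β hβ hδ hmeas hint hmart (fun k => ((hbd k).integrable_rpow hp).1)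
    (fun k => ((hbd k).integrable_rpow hp).2) n
  refine LpLe.of_integral_rpow hp
    (Finset.measurable_fun_sum _ fun k _ => (hmeas k).mono (hF _) le_rfl) (Real.sqrt_nonneg _)
    h1.1 (h1.2.trans (le_of_eq ?_))
  have h0 : 0 ≤ β + K * ∑ k ∈ Finset.range n, δ k ^ 2 := by
    have : 0 ≤ ∑ k ∈ Finset.range n, δ k ^ 2 := Finset.sum_nonneg fun k _ => sq_nonneg _
    positivity
  rw [Real.sqrt_eq_rpow, ← Real.rpow_mul h0]
  congr 1
  ring

/-- Centering at the conditional mean is optimal up to a factor two. -/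
theorem eLpNorm_indicator_sub_cond_integral_le {Ω E : Type*} [MeasurableSpace Ω]
    [NormedAddCommGroup E] [NormedSpace ℝ E] [CompleteSpace E] {P : Measure Ω}
    [IsProbabilityMeasure P] {G : Set Ω} (hG : MeasurableSet G) (hG0 : P G ≠ 0) {Y : Ω → E}
    (hY : Integrable Y P) (c : E) {p : ENNReal} (hp : 1 ≤ p) :
    eLpNorm (G.indicator fun ω => Y ω - ∫ ω, Y ω ∂(ProbabilityTheory.cond P G)) p P
      ≤ 2 * eLpNorm (G.indicator fun ω => Y ω - c) p P := by
  set μ := ProbabilityTheory.cond P G with hμ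
  have : IsProbabilityMeasure μ := cond_isProbabilityMeasure hG0
  have hμ' : μ = (P G)⁻¹ • P.restrict G := rfl
  have hinv0 : (P G)⁻¹ ≠ 0 := ENNReal.inv_ne_zero.2 (measure_ne_top _ _)
  have hYμ : Integrable Y μ := by
    rw [hμ']
    exact hY.integrableOn.smul_measure (ENNReal.inv_ne_top.2 hG0)
  have hmean : ‖c - ∫ ω, Y ω ∂μ‖ₑ ≤ eLpNorm (fun ω => Y ω - c) p μ := by
    have e : c - ∫ ω, Y ω ∂μ = -∫ ω, (Y ω - c) ∂μ := by
      rw [integral_sub hYμ (integrable_const c)]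
      simp
    rw [e, enorm_neg]
    refine (enorm_integral_le_lintegral_enorm _).trans ?_
    rw [← eLpNorm_one_eq_lintegral_enorm]
    exact eLpNorm_le_eLpNorm_of_exponent_le hp
      (hYμ.aestronglyMeasurable.sub aestronglyMeasurable_const)
  have hp0 : p ≠ 0 := (one_pos.trans_le hp).ne'
  have hcond : eLpNorm (fun ω => Y ω - ∫ ω, Y ω ∂μ) p μ ≤ 2 * eLpNorm (fun ω => Y ω - c) p μ := by
    have h1 := eLpNorm_add_le (f := fun ω => Y ω - c) (g := fun _ => c - ∫ ω, Y ω ∂μ) (μ := μ)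
      (hYμ.aestronglyMeasurable.sub aestronglyMeasurable_const) aestronglyMeasurable_const hp
    have e : ((fun ω => Y ω - c) + fun _ => c - ∫ ω, Y ω ∂μ) = fun ω => Y ω - ∫ ω, Y ω ∂μ := by
      ext ω; simp
    rw [e, eLpNorm_const _ hp0 (IsProbabilityMeasure.ne_zero μ)] at h1
    rw [two_mul]
    refine h1.trans (add_le_add le_rfl ?_)
    simpa using hmean
  rw [eLpNorm_indicator_eq_eLpNorm_restrict hG, eLpNorm_indicator_eq_eLpNorm_restrict hG]
  -- passing from `P.restrict G` to the conditional measure rescales both sides by the same factor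
  have hsc : P.restrict G = P G • μ := by
    rw [hμ', smul_smul, ENNReal.mul_inv_cancel hG0 (measure_ne_top _ _), one_smul]
  rw [hsc, eLpNorm_smul_measure_of_ne_zero hG0, eLpNorm_smul_measure_of_ne_zero hG0, smul_eq_mul,
    smul_eq_mul, mul_left_comm]
  gcongr

theorem EuclideanSpace.norm_le_sum_abs {q : ℕ} (y : EuclideanSpace ℝ (Fin q)) :
    ‖y‖ ≤ ∑ l, |y l| := by
  conv_lhs => rw [← (EuclideanSpace.basisFun (Fin q) ℝ).sum_repr y]
  refine (norm_sum_le _ _).trans (Finset.sum_le_sum fun l _ => ?_)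
  rw [norm_smul]
  simp

namespace PolyaUrn

variable {q : ℕ} {U : PolyaUrn q}

/-! ### Moment bounds for the deviation from the comparison process -/

/-- The drift error at step `k`, on survival up to time `k`: the part of the perturbation that comes
from replacing the random total activity by `σ_k`. -/
noncomputable def driftError (U : PolyaUrn q) (b : ℝ) {Ω : Type*}
    (X : ℕ → Ω → EuclideanSpace ℝ (Fin q)) (i : Fin q) (k : ℕ) : Ω → ℝ :=
  (U.nonExtinct X k).indicator fun ω => U.timeStep b k * activityDev U b (fun k => X k ω) k *
    (U.intensityMatrix.mulVec U.unitVec i - U.drift (X k ω) i)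

/-- The martingale that equals `S_n - σ_n` on survival. -/
noncomputable def activityMg (U : PolyaUrn q) {Ω : Type*} (X : ℕ → Ω → EuclideanSpace ℝ (Fin q))
    (n : ℕ) (ω : Ω) : ℝ :=
  ∑ i, (∑ k ∈ Finset.range n, U.mgDiff X i k ω) * U.activity i

theorem measurable_driftError {Ω : Type*} [MeasurableSpace Ω] {P : Measure Ω}
    {X : ℕ → Ω → EuclideanSpace ℝ (Fin q)} (hX : U.IsUrnChain P X) (b : ℝ) (i : Fin q) (k : ℕ) :
    Measurable (U.driftError b X i k) := by
  have h1 := (measurable_totalActivity (U := U)).comp (hX.measurable k)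
  have h2 := (measurable_drift (U := U) i).comp (hX.measurable k)
  refine Measurable.indicator ?_ (hX.past_le k _ (measurableSet_nonExtinct k))
  exact ((measurable_const.mul (h1.sub measurable_const))).mul (measurable_const.sub h2)

theorem activityDev_eq_activityMg {Ω : Type*} {X : ℕ → Ω → EuclideanSpace ℝ (Fin q)} {b : ℝ}
    (hbal : U.BalancedInExpectation b) {n : ℕ} {ω : Ω}
    (h0 : X 0 ω = U.init) (hω : ω ∈ U.nonExtinct X n) :
    activityDev U b (fun k => X k ω) n = U.activityMg X n ω := by
  rw [activityDev_eq_sum (x := fun k => X k ω) hbal h0 (fun k hk => hω k hk.le), Finset.sum_comm,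
    activityMg]
  refine Finset.sum_congr rfl fun i _ => ?_
  rw [Finset.sum_mul]
  refine Finset.sum_congr rfl fun k hk => ?_
  have hωk : ω ∈ U.nonExtinct X k := fun j hj => hω j (hj.trans (Finset.mem_range.1 hk).le)
  rw [mgDiff, Set.indicator_of_mem hωk, mul_comm]

/-- On survival, the deviation from the comparison process splits into martingale transforms, drift
errors, and the deviation of the total activity. -/
theorem sub_comparison_eq_of_mem_nonExtinct {Ω : Type*} {X : ℕ → Ω → EuclideanSpace ℝ (Fin q)}
    {b : ℝ} (hbal : U.BalancedInExpectation b) {n : ℕ} {ω : Ω} (h0 : X 0 ω = U.init)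
    (hω : ω ∈ U.nonExtinct X n) (l : Fin q) :
    X n ω l - U.comparison b n l =
      (∑ i, ∑ k ∈ Finset.range n, U.mgDiff X i k ω *
        (if k < n then U.kernelCoeff b (k + 1) (n - (k + 1)) i l else 0))
      + (∑ k ∈ Finset.range n, ∑ i, U.driftError b X i k ω *
        U.kernelCoeff b (k + 1) (n - (k + 1)) i l)
      + U.activityMg X n ω * U.unitVec l := by
  rw [sub_comparison_eq (x := fun k => X k ω) hbal h0 (fun k hk => hω k hk.le) l,
    activityDev_eq_activityMg hbal h0 hω, Finset.sum_comm (s := Finset.univ),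
    ← Finset.sum_add_distrib]
  congr 1
  refine Finset.sum_congr rfl fun k hk => ?_
  have hk' := Finset.mem_range.1 hk
  have hωk : ω ∈ U.nonExtinct X k := fun j hj => hω j (hj.trans hk'.le)
  rw [← Finset.sum_add_distrib]
  refine Finset.sum_congr rfl fun i _ => ?_
  rw [if_pos hk', mgDiff, driftError, Set.indicator_of_mem hωk, Set.indicator_of_mem hωk,
    perturbation, add_mul]

/-- The moment inequality for the martingale transforms of the noise, with a constant that depends on
the urn and `p` only. -/
theorem exists_lpLe_sum_mgDiff {p : ℝ} (hp : 2 ≤ p)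
    (hmom : ∀ i, MemLp (fun x : EuclideanSpace ℝ (Fin q) => x) (ENNReal.ofReal p)
      (U.replacement i)) :
    ∃ K : ℝ, 0 < K ∧ ∀ {Ω : Type*} [MeasurableSpace Ω] {P : Measure Ω} [IsProbabilityMeasure P]
      {X : ℕ → Ω → EuclideanSpace ℝ (Fin q)}, U.IsUrnChain P X → Tenable P X →
      ∀ (i : Fin q) (w δ : ℕ → ℝ), (∀ k, |w k| ≤ δ k) → (∀ k, 0 < δ k) → ∀ β : ℝ, 0 < β → ∀ n : ℕ,
      LpLe P p (fun ω => ∑ k ∈ Finset.range n, U.mgDiff X i k ω * w k)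
        √(β + K * ∑ k ∈ Finset.range n, δ k ^ 2) := by
  obtain ⟨K, hK, h⟩ := exists_lpLe_sum_martingale hp
  have hκ := U.noiseBound_pos p
  refine ⟨K * U.noiseBound p ^ 2, by positivity, ?_⟩
  intro Ω _ P _ X hX hT i w δ hw hδ β hβ n
  have := U.isProbabilityMeasure_replacement
  have hmom1 : ∀ i, Integrable (fun x : EuclideanSpace ℝ (Fin q) => x) (U.replacement i) := fun i =>
    (hmom i).integrable (ENNReal.one_le_ofReal.2 (by linarith))
  have h1 := h P (past X) past_mono hX.past_le (fun k ω => U.mgDiff X i k ω * w k)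
    (fun k => δ k * U.noiseBound p) β hβ (fun k => mul_pos (hδ k) hκ)
    (fun k => (measurable_mgDiff k i).mul_const _)
    (fun k => (integrable_mgDiff hX hT hmom1 k i).mul_const _)
    (fun k s hs => by
      rw [integral_mul_const, setIntegral_mgDiff hX hT hmom1 k i hs, zero_mul])
    (fun k => LpLe.mul_const ⟨(measurable_mgDiff k i).mono (hX.past_le _) le_rfl, hκ.le,
      eLpNorm_mgDiff_le hX hT hp hmom k i⟩ (hw k)) n
  have e : ∑ k ∈ Finset.range n, (δ k * U.noiseBound p) ^ 2
      = U.noiseBound p ^ 2 * ∑ k ∈ Finset.range n, δ k ^ 2 := by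
    rw [Finset.mul_sum]
    exact Finset.sum_congr rfl fun k _ => by ring
  rwa [e, ← mul_assoc] at h1

/-- The total activity has fluctuations of order `√n`, as for a random walk. -/
theorem exists_lpLe_activityMg {p : ℝ} (hp : 2 ≤ p)
    (hmom : ∀ i, MemLp (fun x : EuclideanSpace ℝ (Fin q) => x) (ENNReal.ofReal p)
      (U.replacement i)) :
    ∃ C : ℝ, 0 ≤ C ∧ ∀ {Ω : Type*} [MeasurableSpace Ω] {P : Measure Ω} [IsProbabilityMeasure P]
      {X : ℕ → Ω → EuclideanSpace ℝ (Fin q)}, U.IsUrnChain P X → Tenable P X →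
      ∀ n : ℕ, LpLe P p (U.activityMg X n) (C * √((n : ℝ) + 1)) := by
  obtain ⟨K, hK, h⟩ := U.exists_lpLe_sum_mgDiff hp hmom
  have hA : 0 ≤ ∑ i, U.activity i := Finset.sum_nonneg fun i _ => U.activity_nonneg i
  refine ⟨(∑ i, U.activity i) * √(1 + K), by positivity, ?_⟩
  intro Ω _ P _ X hX hT n
  have h1 : ∀ i ∈ (Finset.univ : Finset (Fin q)),
      LpLe P p (fun ω => (∑ k ∈ Finset.range n, U.mgDiff X i k ω) * U.activity i)
        (U.activity i * (√(1 + K) * √((n : ℝ) + 1))) := by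
    intro i _
    have h2 := h hX hT i (fun _ => 1) (fun _ => 1) (by simp) (by simp) 1 one_pos n
    simp only [mul_one] at h2
    refine LpLe.mul_const (h2.mono ?_) (abs_of_nonneg (U.activity_nonneg i)).le
    rw [← Real.sqrt_mul (by positivity)]
    refine Real.sqrt_le_sqrt ?_
    have hn : (0 : ℝ) ≤ n := Nat.cast_nonneg n
    simp
    nlinarith
  refine (LpLe.sum (by linarith) _ h1).mono (le_of_eq ?_)
  rw [← Finset.sum_mul]
  ring

/-- The drift error at step `k` is of order `k ^ (-1 / 2)`: the deviation of the total activity,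
of order `√k`, is divided by `σ_k`, and the drift is bounded. -/
theorem exists_lpLe_driftError {p : ℝ} (hp : 2 ≤ p) {b : ℝ} (hbal : U.BalancedInExpectation b)
    (hmom : ∀ i, MemLp (fun x : EuclideanSpace ℝ (Fin q) => x) (ENNReal.ofReal p)
      (U.replacement i)) :
    ∃ C : ℝ, 0 ≤ C ∧ ∀ {Ω : Type*} [MeasurableSpace Ω] {P : Measure Ω} [IsProbabilityMeasure P]
      {X : ℕ → Ω → EuclideanSpace ℝ (Fin q)}, U.IsUrnChain P X → Tenable P X →
      ∀ (i : Fin q) (k : ℕ), LpLe P p (U.driftError b X i k) (C * ((k : ℝ) + 1) ^ (-(1 / 2) : ℝ)) := by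
  obtain ⟨C, hC, h⟩ := U.exists_lpLe_activityMg hp hmom
  obtain ⟨Ct, hCt, ht⟩ := U.exists_timeStep_le_div hbal.1
  set D : ℝ := ∑ i, (|U.intensityMatrix.mulVec U.unitVec i| + ∑ j, |U.meanReplacement j i|) with hD
  have hterm : ∀ i, 0 ≤ |U.intensityMatrix.mulVec U.unitVec i| + ∑ j, |U.meanReplacement j i| :=
    fun i => add_nonneg (abs_nonneg _) (Finset.sum_nonneg fun j _ => abs_nonneg _)
  have hD0 : 0 ≤ D := Finset.sum_nonneg fun i _ => hterm i
  refine ⟨Ct * D * C, by positivity, ?_⟩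
  intro Ω _ P _ X hX hT i k
  have htk := timeStep_pos (U := U) hbal.1 k
  have hDi : |U.intensityMatrix.mulVec U.unitVec i| + ∑ j, |U.meanReplacement j i| ≤ D :=
    Finset.single_le_sum (f := fun i => |U.intensityMatrix.mulVec U.unitVec i|
      + ∑ j, |U.meanReplacement j i|) (fun i _ => hterm i) (Finset.mem_univ i)
  have h1 : LpLe P p (U.driftError b X i k)
      ((U.timeStep b k * D) * (C * √((k : ℝ) + 1))) := by
    refine LpLe.of_ae_abs_le (measurable_driftError hX b i k) (by positivity) (h hX hT k) ?_
    filter_upwards [hX.init_eq, hT k] with ω h0 hω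
    by_cases hm : ω ∈ U.nonExtinct X k
    · rw [driftError, Set.indicator_of_mem hm, activityDev_eq_activityMg hbal h0 hm, abs_mul, abs_mul,
        abs_of_pos htk]
      have h2 : |U.intensityMatrix.mulVec U.unitVec i - U.drift (X k ω) i| ≤ D :=
        (abs_sub _ _).trans ((add_le_add le_rfl (abs_drift_le hω i)).trans hDi)
      calc _ ≤ U.timeStep b k * |U.activityMg X k ω| * D := by gcongr
        _ = _ := by ring
    · rw [driftError, Set.indicator_of_notMem hm, abs_zero]
      positivity
  refine h1.mono ?_
  have hk : (0 : ℝ) < (k : ℝ) + 1 := by positivity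
  have e : 1 / ((k : ℝ) + 1) * √((k : ℝ) + 1) = ((k : ℝ) + 1) ^ (-(1 / 2) : ℝ) := by
    rw [Real.sqrt_eq_rpow, one_div, ← Real.rpow_neg_one, ← Real.rpow_add hk]; norm_num
  calc U.timeStep b k * D * (C * √((k : ℝ) + 1))
      ≤ Ct / (k + 1) * D * (C * √((k : ℝ) + 1)) := by gcongr; exact ht k
    _ = Ct * D * C * (1 / ((k : ℝ) + 1) * √((k : ℝ) + 1)) := by ring
    _ = _ := by rw [e]

theorem stepWeight_pos (r : ℝ) (ν : ℕ) {n : ℕ} (hn : 0 < n) (k : ℕ) : 0 < stepWeight r ν n k := by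
  have : 0 ≤ Real.log n := Real.log_natCast_nonneg n
  unfold stepWeight
  positivity

/-- On survival, each coordinate deviates from the comparison process by at most the rate. -/
theorem exists_lpLe_deviation {p : ℝ} (hp : 2 ≤ p) {b : ℝ} (hbal : U.BalancedInExpectation b)
    (hmom : ∀ i, MemLp (fun x : EuclideanSpace ℝ (Fin q) => x) (ENNReal.ofReal p)
      (U.replacement i)) {β : ℝ} (hβ : 0 < β) {ν : ℕ}
    (hgrow : ∀ (Q : ℝ) (v : Fin q → ℂ), U.activityFunctional v = 0 →
      HasGrowth U.intensityEnd (1 / U.totalActivity U.init) Q β ν v)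
    {rate : ℕ → ℝ} (hrate : IsRate (β / b) ν rate) :
    ∃ C : ℝ, 0 ≤ C ∧ ∀ {Ω : Type*} [MeasurableSpace Ω] {P : Measure Ω} [IsProbabilityMeasure P]
      {X : ℕ → Ω → EuclideanSpace ℝ (Fin q)}, U.IsUrnChain P X → Tenable P X →
      ∀ n : ℕ, 2 ≤ n → ∀ l : Fin q, ∃ Z : Ω → ℝ, LpLe P p Z (C * rate n) ∧
        ∀ᵐ ω ∂P, ω ∈ U.nonExtinct X n → X n ω l - U.comparison b n l = Z ω := by
  have hp1 : 1 ≤ p := by linarith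
  obtain ⟨Cr, hCr, hr⟩ := hrate
  obtain ⟨Ck, hCk, hker⟩ := U.abs_kernelCoeff_le hbal.1 hβ hgrow
  obtain ⟨K, hK, hmg⟩ := U.exists_lpLe_sum_mgDiff hp hmom
  obtain ⟨Ca, hCa, hact⟩ := U.exists_lpLe_activityMg hp hmom
  obtain ⟨Ce, hCe, herr⟩ := U.exists_lpLe_driftError hp hbal hmom
  set W : ℝ := ∑ l, |U.unitVec l| with hW
  have hW0 : 0 ≤ W := Finset.sum_nonneg fun l _ => abs_nonneg _
  refine ⟨q * (Cr * √(1 + K * Ck ^ 2)) + q * (Ck * Ce * Cr) + W * (Ca * (2 * Cr)), by positivity, ?_⟩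
  intro Ω _ P _ X hX hT n hn l
  obtain ⟨hR0, hRn, hRsq, hRsum⟩ := hr n hn
  have hn0 : (0 : ℝ) < n := by exact_mod_cast (by omega : 0 < n)
  -- the martingale transforms
  have h1 : LpLe P p (fun ω => ∑ i, ∑ k ∈ Finset.range n, U.mgDiff X i k ω *
      (if k < n then U.kernelCoeff b (k + 1) (n - (k + 1)) i l else 0))
      (q * (Cr * √(1 + K * Ck ^ 2)) * rate n) := by
    have h2 : ∀ i ∈ (Finset.univ : Finset (Fin q)), LpLe P p
        (fun ω => ∑ k ∈ Finset.range n, U.mgDiff X i k ω *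
          (if k < n then U.kernelCoeff b (k + 1) (n - (k + 1)) i l else 0))
        (Cr * √(1 + K * Ck ^ 2) * rate n) := by
      intro i _
      have hpos : ∀ k, 0 < Ck * stepWeight (β / b) ν n k := fun k =>
        mul_pos hCk (stepWeight_pos _ _ (by omega) k)
      -- the offset `n > 0` of the moment inequality is harmless, as the rate is at least `√n`
      refine (hmg hX hT i (fun k => if k < n then U.kernelCoeff b (k + 1) (n - (k + 1)) i l else 0)
        (fun k => Ck * stepWeight (β / b) ν n k) (fun k => ?_) hpos n hn0 n).mono ?_
      · by_cases hk : k < n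
        · simpa [hk] using hker n k hk i l
        · simpa [hk] using (hpos k).le
      · rw [Real.sqrt_le_left (by positivity)]
        have e1 : ∑ k ∈ Finset.range n, (Ck * stepWeight (β / b) ν n k) ^ 2
            = Ck ^ 2 * ∑ k ∈ Finset.range n, stepWeight (β / b) ν n k ^ 2 := by
          rw [Finset.mul_sum]; exact Finset.sum_congr rfl fun k _ => by ring
        have e2 : (n : ℝ) ≤ (Cr * rate n) ^ 2 := by
          have h3 := pow_le_pow_left₀ (by positivity) hRn 2
          rwa [← Real.rpow_two, ← Real.rpow_mul hn0.le, show (1 / 2 : ℝ) * 2 = 1 by norm_num,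
            Real.rpow_one] at h3
        have e3 : √(1 + K * Ck ^ 2) ^ 2 = 1 + K * Ck ^ 2 := Real.sq_sqrt (by positivity)
        rw [e1]
        calc (n : ℝ) + K * (Ck ^ 2 * ∑ k ∈ Finset.range n, stepWeight (β / b) ν n k ^ 2)
            ≤ (Cr * rate n) ^ 2 + K * (Ck ^ 2 * (Cr * rate n) ^ 2) := by gcongr
          _ = (Cr * √(1 + K * Ck ^ 2) * rate n) ^ 2 := by
            linear_combination (-(Cr * rate n) ^ 2) * e3
    refine (LpLe.sum hp1 _ h2).mono (le_of_eq ?_)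
    simp
    ring
  -- the drift errors
  have h3 : LpLe P p (fun ω => ∑ k ∈ Finset.range n, ∑ i, U.driftError b X i k ω *
        U.kernelCoeff b (k + 1) (n - (k + 1)) i l) (q * (Ck * Ce * Cr) * rate n) := by
    have h4 : ∀ k ∈ Finset.range n, LpLe P p (fun ω => ∑ i, U.driftError b X i k ω *
        U.kernelCoeff b (k + 1) (n - (k + 1)) i l)
        (∑ _i : Fin q, Ck * stepWeight (β / b) ν n k * (Ce * ((k : ℝ) + 1) ^ (-(1 / 2) : ℝ))) :=
      fun k hk => LpLe.sum hp1 _ fun i _ =>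
        (herr hX hT i k).mul_const (hker n k (Finset.mem_range.1 hk) i l)
    refine (LpLe.sum hp1 _ h4).mono ?_
    calc ∑ k ∈ Finset.range n, ∑ _i : Fin q,
          Ck * stepWeight (β / b) ν n k * (Ce * ((k : ℝ) + 1) ^ (-(1 / 2) : ℝ))
        = q * (Ck * Ce) * ∑ k ∈ Finset.range n,
            stepWeight (β / b) ν n k * ((k : ℝ) + 1) ^ (-(1 / 2) : ℝ) := by
          rw [Finset.mul_sum]
          refine Finset.sum_congr rfl fun k _ => ?_
          rw [Finset.sum_const, Finset.card_univ, Fintype.card_fin, nsmul_eq_mul]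
          ring
      _ ≤ q * (Ck * Ce) * (Cr * rate n) := by gcongr
      _ = _ := by ring
  -- the deviation of the total activity
  have h5 : LpLe P p (fun ω => U.activityMg X n ω * U.unitVec l) (W * (Ca * (2 * Cr)) * rate n) := by
    have hl : |U.unitVec l| ≤ W :=
      Finset.single_le_sum (f := fun l => |U.unitVec l|) (fun l _ => abs_nonneg _)
        (Finset.mem_univ l)
    refine ((hact hX hT n).mul_const hl).mono ?_
    have h6 : √((n : ℝ) + 1) ≤ 2 * (Cr * rate n) := by
      refine le_trans ?_ (mul_le_mul_of_nonneg_left hRn zero_le_two)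
      rw [← Real.sqrt_eq_rpow, Real.sqrt_le_left (by positivity), mul_pow, Real.sq_sqrt hn0.le]
      have : (1 : ℝ) ≤ n := by exact_mod_cast (by omega : 1 ≤ n)
      linarith
    calc W * (Ca * √((n : ℝ) + 1)) ≤ W * (Ca * (2 * (Cr * rate n))) := by gcongr
      _ = _ := by ring
  refine ⟨_, ((h1.add hp1 h3).add hp1 h5).mono (le_of_eq ?_), ?_⟩
  · ring
  · filter_upwards [hX.init_eq] with ω h0 hω
    exact sub_comparison_eq_of_mem_nonExtinct hbal h0 hω l

/-- The moment bound for an abstract rate. -/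
theorem exists_eLpNorm_centered_le {p : ℝ} (hp : 2 ≤ p) {b : ℝ} (hbal : U.BalancedInExpectation b)
    (hmom : ∀ i, MemLp (fun x : EuclideanSpace ℝ (Fin q) => x) (ENNReal.ofReal p)
      (U.replacement i)) {β : ℝ} (hβ : 0 < β) {ν : ℕ}
    (hgrow : ∀ (Q : ℝ) (v : Fin q → ℂ), U.activityFunctional v = 0 →
      HasGrowth U.intensityEnd (1 / U.totalActivity U.init) Q β ν v)
    {rate : ℕ → ℝ} (hrate : IsRate (β / b) ν rate) :
    ∃ C : ℝ, ∀ {Ω : Type*} [MeasurableSpace Ω] {P : Measure Ω} [IsProbabilityMeasure P]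
      {X : ℕ → Ω → EuclideanSpace ℝ (Fin q)}, U.IsUrnChain P X → Tenable P X →
      ∀ n : ℕ, 2 ≤ n →
        eLpNorm (U.centered P X n) (ENNReal.ofReal p) P ≤ ENNReal.ofReal (C * rate n) := by
  obtain ⟨C, hC, h⟩ := U.exists_lpLe_deviation hp hbal hmom hβ hgrow hrate
  refine ⟨2 * (q * C), ?_⟩
  intro Ω _ P _ X hX hT n hn
  have := U.isProbabilityMeasure_replacement
  have hmom1 : ∀ i, Integrable (fun x : EuclideanSpace ℝ (Fin q) => x) (U.replacement i) := fun i =>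
    (hmom i).integrable (ENNReal.one_le_ofReal.2 (by linarith))
  have hG := hX.past_le n _ (measurableSet_nonExtinct (U := U) n)
  have h1 := eLpNorm_indicator_sub_cond_integral_le hG
    (measure_nonExtinct_pos hX hT hmom1 hbal n).ne' (integrable_process hX hT hmom1 n)
    (WithLp.toLp 2 (U.comparison b n)) (p := ENNReal.ofReal p)
    (ENNReal.one_le_ofReal.2 (by linarith))
  refine h1.trans ?_
  choose Z hZ hZeq using fun l => h hX hT n hn l
  have hsum : LpLe P p (fun ω => ∑ l, |Z l ω|) (q * C * rate n) := by
    refine (LpLe.sum (by linarith) _ fun l _ => (hZ l).abs).mono (le_of_eq ?_)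
    simp
    ring
  have hle : eLpNorm ((U.nonExtinct X n).indicator
      fun ω => X n ω - WithLp.toLp 2 (U.comparison b n)) (ENNReal.ofReal p) P
      ≤ eLpNorm (fun ω => ∑ l, |Z l ω|) (ENNReal.ofReal p) P := by
    refine eLpNorm_mono_ae_real ?_
    filter_upwards [ae_all_iff.2 hZeq] with ω hω
    by_cases hm : ω ∈ U.nonExtinct X n
    · rw [Set.indicator_of_mem hm]
      refine (EuclideanSpace.norm_le_sum_abs _).trans (le_of_eq ?_)
      refine Finset.sum_congr rfl fun l _ => ?_
      rw [← hω l hm]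
      rfl
    · rw [Set.indicator_of_notMem hm, norm_zero]
      exact Finset.sum_nonneg fun l _ => abs_nonneg _
  calc _ ≤ 2 * ENNReal.ofReal (q * C * rate n) := by gcongr; exact hle.trans hsum.2.2
    _ = ENNReal.ofReal (2 * (q * C) * rate n) := by
      rw [show 2 * (q * C) * rate n = 2 * (q * C * rate n) by ring, ENNReal.ofReal_mul zero_le_two,
        ENNReal.ofReal_ofNat]

end PolyaUrn

theorem mainTheorem2 {q : ℕ} (hq : 2 ≤ q) (U : PolyaUrn q) (b : ℝ)
    (hbal : U.BalancedInExpectation b)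
    (ev : Fin q → ℂ) (hev : U.IsEigenvalueLabelling b ev)
    (p : ℝ) (hp : 2 ≤ p)
    (hmom : ∀ i, MemLp (fun x : EuclideanSpace ℝ (Fin q) => x) (ENNReal.ofReal p)
      (U.replacement i)) :
    ∃ C : ℝ, ∀ (Ω : Type*) [MeasurableSpace Ω] (P : Measure Ω) [IsProbabilityMeasure P]
      (X : ℕ → Ω → EuclideanSpace ℝ (Fin q)),
      U.IsUrnChain P X → PolyaUrn.Tenable P X →
      ∀ n : ℕ, 2 ≤ n →
        0 < P (U.nonExtinct X n) ∧
        Integrable (X n) P ∧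
        ((ev ⟨1, hq⟩).re < b / 2 →
          eLpNorm (U.centered P X n) (ENNReal.ofReal p) P
            ≤ ENNReal.ofReal (C * (n : ℝ) ^ (1 / 2 : ℝ))) ∧
        ((ev ⟨1, hq⟩).re = b / 2 →
          eLpNorm (U.centered P X n) (ENNReal.ofReal p) P
            ≤ ENNReal.ofReal
              (C * (n : ℝ) ^ (1 / 2 : ℝ) * Real.log n ^ (U.nu (ev ⟨1, hq⟩) + 1))) ∧
        (b / 2 < (ev ⟨1, hq⟩).re →
          eLpNorm (U.centered P X n) (ENNReal.ofReal p) P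
            ≤ ENNReal.ofReal
              (C * (n : ℝ) ^ ((ev ⟨1, hq⟩).re / b) * Real.log n ^ U.nu (ev ⟨1, hq⟩))) := by
  have hb := hbal.1
  have := U.isProbabilityMeasure_replacement
  have hmom1 : ∀ i, Integrable (fun x : EuclideanSpace ℝ (Fin q) => x) (U.replacement i) := fun i =>
    (hmom i).integrable (ENNReal.one_le_ofReal.2 (by linarith))
  set ρ := (ev ⟨1, hq⟩).re with hρ
  set ν := U.nu (ev ⟨1, hq⟩) with hν
  have hgrow : ∀ (Q : ℝ) (v : Fin q → ℂ), U.activityFunctional v = 0 →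
      HasGrowth U.intensityEnd (1 / U.totalActivity U.init) Q ρ ν v := fun Q v hv =>
    PolyaUrn.hasGrowth_intensityEnd hq hbal hev (one_div_pos.2 U.totalActivity_init_pos).le hv
  rcases lt_trichotomy ρ (b / 2) with hlt | heq | hgt
  · -- an exponent strictly between `max (Re λ₂) 0` and `b / 2`, at which the logarithms disappear
    obtain ⟨β, hβ1, hβ2⟩ := exists_between (max_lt hlt (by linarith : (0 : ℝ) < b / 2))
    have hβ0 : 0 < β := (le_max_right _ _).trans_lt hβ1
    obtain ⟨C, hC⟩ := PolyaUrn.exists_eLpNorm_centered_le hp hbal hmom hβ0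
      (fun Q v hv => (hgrow Q v hv).of_lt ((le_max_left _ _).trans_lt hβ1))
      (isRate_of_lt_half (r := β / b) (by positivity) (by rw [div_lt_iff₀ hb]; linarith))
    exact ⟨C, fun Ω _ P _ X hX hT n hn =>
      ⟨PolyaUrn.measure_nonExtinct_pos hX hT hmom1 hbal n,
        PolyaUrn.integrable_process hX hT hmom1 n, fun _ => hC hX hT n hn,
        fun h => absurd h hlt.ne, fun h => absurd h hlt.not_gt⟩⟩
  · have hβ : ρ / b = 1 / 2 := by rw [heq]; field_simp
    obtain ⟨C, hC⟩ := PolyaUrn.exists_eLpNorm_centered_le hp hbal hmom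
      (by rw [heq]; linarith) hgrow
      (rate := fun n => (n : ℝ) ^ (1 / 2 : ℝ) * Real.log n ^ (ν + 1))
      (by rw [hβ]; exact isRate_of_eq_half ν)
    exact ⟨C, fun Ω _ P _ X hX hT n hn =>
      ⟨PolyaUrn.measure_nonExtinct_pos hX hT hmom1 hbal n,
        PolyaUrn.integrable_process hX hT hmom1 n, fun h => absurd h heq.not_lt,
        fun _ => by simpa only [mul_assoc] using hC hX hT n hn, fun h => absurd h heq.not_gt⟩⟩
  · obtain ⟨C, hC⟩ := PolyaUrn.exists_eLpNorm_centered_le hp hbal hmom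
      (by linarith) hgrow (isRate_of_half_lt (r := ρ / b) (by rw [lt_div_iff₀ hb]; linarith) ν)
    exact ⟨C, fun Ω _ P _ X hX hT n hn =>
      ⟨PolyaUrn.measure_nonExtinct_pos hX hT hmom1 hbal n,
        PolyaUrn.integrable_process hX hT hmom1 n, fun h => absurd h hgt.not_gt,
        fun h => absurd h hgt.ne', fun _ => by simpa only [mul_assoc] using hC hX hT n hn⟩⟩
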